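/- Let $q>2$ be a prime power, let $n=q^2+1$, and let $\lambda\in\mathbb F_{q^2}^*$ have multiplicative order $r$, where $r\mid q-1$ and $\nu_2(r)=\nu_2(q-1)$ ($\nu_2$ is the $2$-adic valuation). Let $\delta\in\mathbb F_{q^4}$ be a primitive $rn$-th root of unity with $\delta^n=\lambda$, and for an integer $i\ge 0$ let $g_i(x)$ be the minimal polynomial of $\delta^i$ over $\mathbb F_{q^2}$. Then $g_1(x)\,g_{q^2-q+1}(x)$ divides $x^n-\lambda$. Let $\mathcal C=\mathcal C(1,q^2-q+1)\subseteq\mathbb F_{q^2}^{\,n}$ be the $\lambda$-constacyclic code of length $n$ with check polynomial $g_1(x)g_{q^2-q+1}(x)$, that is, the set of vectors $(c_0,\dots,c_{n-1})$ for which $\sum_i c_ix^i$ lies in the ideal of $\mathbb F_{q^2}[x]/\langle x^n-\lambda\rangle$ generated by $(x^n-\lambda)/(g_1(x)g_{q^2-q+1}(x))$. Then $\mathcal C$ is a $[q^2+1,4,q^2-q]$ code over $\mathbb F_{q^2}$ (length, dimension, minimum Hamming distance) with weight enumerator \[ 1+(q^5-q)z^{q^2-q}+\frac{(q^4-1)(q-1)q^3}{2}\bigl(z^{q^2-1}+z^{q^2+1}\bigr)+(q^7-q^5+q^4-q^3+q-1)z^{q^2},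 \] and the supports of the codewords of minimum weight $q^2-q$ in $\mathcal C$ (taken without repetition) form the blocks of a $3$-$(q^2+1,\,q^2-q,\,(q^2-q-1)(q-2))$ design on the set of coordinate positions. The Euclidean dual $\mathcal C^\perp$ is a $[q^2+1,q^2-3,4]$ code over $\mathbb F_{q^2}$, and the supports of its codewords of minimum weight $4$ (taken without repetition) form the blocks of a $3$-$(q^2+1,4,q-2)$ design. -/

import Mathlib

namespace ConstacyclicDesign

open Polynomial

section Codes

variable {F : Type*} [Field F] {n : ℕ}

/-- The identification `(c₀, …, c_{n-1}) ↦ ∑ cᵢ xⁱ` of `Fⁿ` with `F[x]/⟨xⁿ - lam⟩`. -/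
noncomputable def toQuotient (n : ℕ) (lam : F) :
    (Fin n → F) →ₗ[F] AdjoinRoot (X ^ n - C lam : F[X]) :=
  ∑ i : Fin n, (LinearMap.proj i : (Fin n → F) →ₗ[F] F).smulRight
    (AdjoinRoot.root (X ^ n - C lam : F[X]) ^ (i : ℕ))

/-- The `lam`-constacyclic code of length `n` generated by `g`: all vectors whose associated
polynomial lies in the ideal `⟨g⟩` of `F[x]/⟨xⁿ - lam⟩`. -/
noncomputable def constacyclicCode (n : ℕ) (lam : F) (g : F[X]) : Submodule F (Fin n → F) :=
  ((Ideal.span {AdjoinRoot.mk (X ^ n - C lam : F[X]) g}).restrictScalars F).comap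
    (toQuotient n lam)

/-- The `lam`-constacyclic code of length `n` with check polynomial `h`, where
`h ∣ xⁿ - lam`; its generator polynomial is `(xⁿ - lam) / h`. -/
noncomputable def codeOfCheckPoly (n : ℕ) (lam : F) (h : F[X]) : Submodule F (Fin n → F) :=
  constacyclicCode n lam ((X ^ n - C lam) / h)

/-- The (Euclidean) dual code. -/
def dualCode (D : Submodule F (Fin n → F)) : Submodule F (Fin n → F) where
  carrier := {x | ∀ c ∈ D, ∑ i, c i * x i = 0}
  add_mem' := by
    intro x y hx hy c hc
    simp only [Pi.add_apply, mul_add, Finset.sum_add_distrib]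
    rw [hx c hc, hy c hc, add_zero]
  zero_mem' := by
    intro c _
    simp
  smul_mem' := by
    intro a x hx c hc
    simp only [Pi.smul_apply, smul_eq_mul, mul_left_comm _ a, ← Finset.mul_sum]
    rw [hx c hc, mul_zero]

open Classical in
/-- `D` is an `[n, k, d]` code, `n` being the length of its ambient space: it has dimension `k`
and minimum Hamming distance `d`. -/
def HasParameters (D : Submodule F (Fin n → F)) (k d : ℕ) : Prop :=
  Module.finrank F D = k ∧
    IsLeast {w : ℕ | ∃ x ∈ D, ∃ y ∈ D, x ≠ y ∧ hammingDist x y = w} d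

open Classical in
/-- The number `A_w` of codewords of Hamming weight `w`. -/
noncomputable def weightCount (D : Submodule F (Fin n → F)) (w : ℕ) : ℕ :=
  {c : Fin n → F | c ∈ D ∧ hammingNorm c = w}.ncard

/-- The weight enumerator `A_0 + A_1 z + ⋯ + A_n zⁿ`. -/
noncomputable def weightEnumerator (D : Submodule F (Fin n → F)) : ℚ[X] :=
  ∑ w ∈ Finset.range (n + 1), C (weightCount D w : ℚ) * X ^ w

open Classical in
/-- The support of a vector. -/
noncomputable def supp (c : Fin n → F) : Finset (Fin n) :=
  Finset.univ.filter fun i => c i ≠ 0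

open Classical in
/-- The set of supports of the codewords of weight `w`, without repeated blocks. -/
def supportBlocks (D : Submodule F (Fin n → F)) (w : ℕ) : Set (Finset (Fin n)) :=
  {b | ∃ c ∈ D, hammingNorm c = w ∧ supp c = b}

end Codes

/-- The points `P` and the block set `B` form a (simple) `t`-`(v, k, η)` design. -/
def IsDesign {P : Type*} [Fintype P] (B : Set (Finset P)) (t v k η : ℕ) : Prop :=
  Fintype.card P = v ∧ 1 ≤ k ∧ k ≤ v ∧ (∀ b ∈ B, b.card = k) ∧
    ∀ T : Finset P, T.card = t → {b ∈ B | T ⊆ b}.ncard = η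

/-- The codewords of weight `w` in `D` support a `t`-`(n, w, η)` design. -/
def SupportsDesign {F : Type*} [Field F] {n : ℕ} (D : Submodule F (Fin n → F))
    (t w η : ℕ) : Prop :=
  0 < t ∧ 0 < η ∧ 1 ≤ w ∧ w ≤ n ∧ weightCount D w ≠ 0 ∧ IsDesign (supportBlocks D w) t n w η

/-- The check polynomial `g₁(x) g_{q²-q+1}(x)`, where `gᵢ` is the minimal polynomial of `δⁱ`
over `F`. -/
noncomputable def checkPoly (F : Type*) {E : Type*} [Field F] [Field E] [Algebra F E]
    (q : ℕ) (δ : E) : F[X] :=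
  minpoly F δ * minpoly F (δ ^ (q ^ 2 - q + 1))

/-- The code `𝒞(1, q²-q+1)`: the `lam`-constacyclic code of length `q² + 1` over `F` with
check polynomial `g₁(x) g_{q²-q+1}(x)`. -/
noncomputable def secondCode {F E : Type*} [Field F] [Field E] [Algebra F E]
    (q : ℕ) (lam : F) (δ : E) : Submodule F (Fin (q ^ 2 + 1) → F) :=
  codeOfCheckPoly (q ^ 2 + 1) lam (checkPoly F q δ)

end ConstacyclicDesign

/-! Since `δ ^ ((q - 1) * (q ^ 2 + 1)) = 1`, the power `δ ^ (q ^ 2 - q + 1)` equals `δ ^ q ^ 3`, so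
the check polynomial vanishes at δ, δ^q, δ^{q²}, δ^{q³}. By a dimension count the code consists of
the words with entries Tr(a x + b x^q), where x = δ⁻ⁱ, a and b lie in `E`, and Tr is the trace from
`E` to `F`. With s = x^{q-1} such an entry is x P(s), where P = A X^{q+1} + B X^q + b X + a, A =
a^{q²}, B = b^{q²}. The 2-adic condition on r makes s run exactly once through the (q²+1)-th roots
of unity.

The heart of the matter is that, for (a, b) ≠ 0, P has 0, 1, 2 or q+1 zeros among these roots of
unity. Raising P(s) = 0 to the q-th power and eliminating s^q leaves a quadratic equation for s.
Three zeros force its coefficients to vanish, and these identities make P a divisor of X^{q²+1} - 1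
(`circlePoly_dvd`), which has simple roots. Moreover, vanishing at two positions never forces
vanishing at a third (`traceWord_separates`).

The rest follows from these two facts and dimension four, collected in `IsOvoidCode`. Three
positions determine a nonzero word up to a scalar, so the zero sets with at least three points
("circles") form a 3-(q²+1, q+1, 1) design, an inversive plane. Minimum weight supports are
complements of circles, and inclusion-exclusion counts those containing three given points. Four
moment equations give the weight distribution. A dual word of weight 4 lives on four concyclic
positions, which yields q - 2 blocks through each triple. -/

namespace ConstacyclicDesign

open Polynomial

/-! ### Zeros of circle polynomials among the roots of unity. -/

section CirclePoly

variable {E : Type*} [Field E]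

/-- The polynomial `A X^{q+1} + B X^q + b X + a`, whose zeros among the `(q²+1)`-th roots of unity
are the points of a circle. -/
noncomputable def circlePoly (q : ℕ) (a b A B : E) : E[X] :=
  C A * X ^ (q + 1) + C B * X ^ q + C b * X + C a

lemma eval_circlePoly (q : ℕ) (a b A B s : E) :
    (circlePoly q a b A B).eval s = A * s ^ (q + 1) + B * s ^ q + b * s + a := by
  simp [circlePoly]

lemma natDegree_circlePoly_le (q : ℕ) (a b A B : E) :
    (circlePoly q a b A B).natDegree ≤ q + 1 := by
  unfold circlePoly
  compute_degree

lemma natDegree_circlePoly {q : ℕ} (hq : 2 ≤ q) {A : E} (hA : A ≠ 0) (a b B : E) :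
    (circlePoly q a b A B).natDegree = q + 1 := by
  refine natDegree_eq_of_le_of_coeff_ne_zero (natDegree_circlePoly_le q a b A B) ?_
  have h : (1 : ℕ) ≠ q + 1 := by omega
  have h' : q ≠ 0 := by omega
  simpa [circlePoly, coeff_X_pow, coeff_C, coeff_X, h, h'] using hA

lemma quadratic_coeffs_eq_zero {x y z u v w : E} (hxy : x ≠ y) (hxz : x ≠ z) (hyz : y ≠ z)
    (hx : u * x ^ 2 + v * x + w = 0) (hy : u * y ^ 2 + v * y + w = 0)
    (hz : u * z ^ 2 + v * z + w = 0) : u = 0 ∧ v = 0 ∧ w = 0 := by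
  have h1 : u * (x + y) + v = 0 := by
    apply mul_left_cancel₀ (sub_ne_zero.mpr hxy)
    linear_combination hx - hy
  have h2 : u * (x + z) + v = 0 := by
    apply mul_left_cancel₀ (sub_ne_zero.mpr hxz)
    linear_combination hx - hz
  have hu : u = 0 := by
    apply mul_left_cancel₀ (sub_ne_zero.mpr hyz)
    linear_combination h1 - h2
  subst hu
  have hv : v = 0 := by linear_combination h1
  subst hv
  exact ⟨rfl, rfl, by linear_combination hx⟩

variable (p m : ℕ) [Fact p.Prime] [CharP E p]

/-- On the `(q²+1)`-th roots of unity, the equation `P(s) = 0` together with its `q`-th power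
gives a quadratic equation for `s`. -/
lemma circlePoly_root_quadratic {q : ℕ} (hq : q = p ^ m) {a b A B s : E}
    (hs : s ^ (q ^ 2 + 1) = 1) (h : (circlePoly q a b A B).eval s = 0) :
    (b * b ^ q - a ^ q * A) * s ^ 2 + (b * A ^ q + a * b ^ q - a ^ q * B - B ^ q * A) * s
      + (a * A ^ q - B ^ q * B) = 0 := by
  rw [eval_circlePoly] at h
  have hs0 : s ≠ 0 := by
    rintro rfl
    simp at hs
  -- The q-th power of P(s) = 0, multiplied by s and reduced with s^{q²+1} = 1.
  have h2 : A ^ q * s ^ q + B ^ q + b ^ q * s ^ (q + 1) + a ^ q * s = 0 := by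
    have h3 : (A * s ^ (q + 1) + B * s ^ q + b * s + a) ^ q = 0 := by
      rw [h, zero_pow]
      rw [hq]
      exact pow_ne_zero _ (Fact.out : p.Prime).ne_zero
    have h4 : A ^ q * s ^ (q ^ 2 + q) + B ^ q * s ^ (q ^ 2) + b ^ q * s ^ q + a ^ q = 0 := by
      rw [← h3]
      conv_rhs => rw [hq]
      rw [add_pow_char_pow, add_pow_char_pow, add_pow_char_pow, ← hq]
      ring
    have h5 : s * (A ^ q * s ^ (q ^ 2 + q) + B ^ q * s ^ (q ^ 2) + b ^ q * s ^ q + a ^ q)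
        = s ^ (q ^ 2 + 1) * (A ^ q * s ^ q + B ^ q) + b ^ q * s ^ (q + 1) + a ^ q * s := by ring
    rw [h4, hs, mul_zero] at h5
    linear_combination -h5
  rw [pow_succ s q] at h h2
  -- Both equations are linear in s^q; eliminating their parts free of s^q leaves s^q times the
  -- quadratic.
  apply mul_left_cancel₀ (pow_ne_zero q hs0)
  linear_combination (b * s + a) * h2 - (a ^ q * s + B ^ q) * h

/-- A polynomial `A X^{q+1} + B X^q + b X + a` with three zeros among the `(q²+1)`-th roots of
unity, where `A` and `B` are the conjugates of `a` and `b`, divides `X^{q²+1} - 1`. -/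
theorem circlePoly_dvd {q : ℕ} (hq : q = p ^ m) {a b A B : E}
    (hA : A = a ^ q ^ 2) (hab : a ≠ 0 ∨ b ≠ 0) {x y z : E}
    (hxy : x ≠ y) (hxz : x ≠ z) (hyz : y ≠ z)
    (hx : x ^ (q ^ 2 + 1) = 1) (hy : y ^ (q ^ 2 + 1) = 1) (hz : z ^ (q ^ 2 + 1) = 1)
    (hPx : (circlePoly q a b A B).eval x = 0) (hPy : (circlePoly q a b A B).eval y = 0)
    (hPz : (circlePoly q a b A B).eval z = 0) :
    A ≠ 0 ∧ circlePoly q a b A B ∣ X ^ (q ^ 2 + 1) - 1 := by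
  have hq0 : q ≠ 0 := by
    rw [hq]
    exact pow_ne_zero _ (Fact.out : p.Prime).ne_zero
  have hfrob : Function.Injective fun s : E => s ^ q := by
    intro s t hst
    have h : (s - t) ^ q = 0 := by
      simp only at hst
      rw [hq, sub_pow_char_pow, ← hq, hst, sub_self]
    exact sub_eq_zero.mp (pow_eq_zero_iff hq0 |>.mp h)
  obtain ⟨h2, h1, h0⟩ := quadratic_coeffs_eq_zero hxy hxz hyz
    (circlePoly_root_quadratic p m hq hx hPx) (circlePoly_root_quadratic p m hq hy hPy)
    (circlePoly_root_quadratic p m hq hz hPz)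
  have hA0 : A ≠ 0 := by
    intro hA0
    have ha : a = 0 := by
      rw [hA] at hA0
      exact pow_eq_zero_iff (pow_ne_zero 2 hq0) |>.mp hA0
    have hb : b = 0 := by
      rw [hA0, mul_zero, sub_zero, ← pow_succ'] at h2
      exact pow_eq_zero_iff (Nat.succ_ne_zero q) |>.mp h2
    exact hab.elim (fun h => h ha) (fun h => h hb)
  refine ⟨hA0, ?_⟩
  -- If this determinant vanished, A P(s) would factor as (A s + B)(A s^q + b). Each factor has at
  -- most one zero, the second because Frobenius is injective, so three zeros are impossible.
  have hΔ : b * B - a * A ≠ 0 := by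
    intro hΔ
    have key : ∀ s : E, (circlePoly q a b A B).eval s = 0 → s = -B / A ∨ s ^ q = -b / A := by
      intro s hs
      rw [eval_circlePoly] at hs
      have : (A * s + B) * (A * s ^ q + b) = 0 := by
        rw [pow_succ] at hs
        linear_combination A * hs + hΔ
      rcases mul_eq_zero.mp this with h | h
      · left
        rw [eq_div_iff hA0]
        linear_combination h
      · right
        rw [eq_div_iff hA0]
        linear_combination h
    rcases key x hPx with h | h <;> rcases key y hPy with h' | h' <;>
      rcases key z hPz with h'' | h''
    · exact hxy (h.trans h'.symm)
    · exact hxy (h.trans h'.symm)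
    · exact hxz (h.trans h''.symm)
    · exact hyz (hfrob (h'.trans h''.symm))
    · exact hyz (h'.trans h''.symm)
    · exact hxz (hfrob (h.trans h''.symm))
    · exact hxy (hfrob (h.trans h'.symm))
    · exact hxy (hfrob (h.trans h'.symm))
  have e2 : C b * C b ^ q = C a ^ q * C A := by
    rw [← C_pow, ← C_pow, ← C_mul, ← C_mul, sub_eq_zero.mp h2]
  have e1 : C b * C A ^ q + C a * C b ^ q = C a ^ q * C B + C B ^ q * C A := by
    simp only [← C_pow, ← C_mul, ← C_add]
    congr 1
    linear_combination h1
  have e0 : C a * C A ^ q = C B ^ q * C B := by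
    rw [← C_pow, ← C_pow, ← C_mul, ← C_mul, sub_eq_zero.mp h0]
  have hP : circlePoly q a b A B = C A * X ^ (q + 1) + C B * X ^ q + C b * X + C a := rfl
  generalize circlePoly q a b A B = P at hP ⊢
  set L : E[X] := C A * X + C B with hL
  set P₂ : E[X] := C b ^ q * X ^ (q + 1) + C A ^ q * X ^ q + C a ^ q * X + C B ^ q with hP₂
  -- P is congruent to bX + a modulo L = AX + B, and the determinant of these two linear polynomials
  -- is nonzero.
  have hcop : IsCoprime P L := by
    have hu : C (b * B - a * A)⁻¹ * (C b * C B - C a * C A) = 1 := by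
      rw [← C_mul, ← C_mul, ← C_sub, ← C_mul, inv_mul_cancel₀ hΔ, C_1]
    refine ⟨-C A * C (b * B - a * A)⁻¹, (C b + C A * X ^ q) * C (b * B - a * A)⁻¹, ?_⟩
    rw [← hu, hP, hL]
    ring
  -- The vanishing of the quadratic says (bX + a)(b^q X + A^q) = (a^q X + B^q) L, whence L P₂ = (b^q
  -- X + A^q) P.
  have hPP₂ : P ∣ P₂ := by
    refine hcop.dvd_of_dvd_mul_left ⟨C b ^ q * X + C A ^ q, ?_⟩
    rw [hP, hL, hP₂]
    linear_combination -X ^ 2 * e2 - X * e1 - e0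
  have hfinal : P ∣ L ^ q * (X ^ (q ^ 2 + 1) - 1) := by
    have : L ^ q * (X ^ (q ^ 2 + 1) - 1) = X * P ^ q - P₂ := by
      have e3 : P ^ q = C A ^ q * X ^ (q ^ 2 + q) + C B ^ q * X ^ (q ^ 2) + C b ^ q * X ^ q
          + C a ^ q := by
        rw [hP]
        conv_lhs => rw [hq]
        rw [add_pow_char_pow, add_pow_char_pow, add_pow_char_pow, ← hq]
        ring
      have e4 : L ^ q = C A ^ q * X ^ q + C B ^ q := by
        rw [hL]
        conv_lhs => rw [hq]
        rw [add_pow_char_pow, ← hq]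
        ring
      rw [e3, e4, hP₂]
      ring
    rw [this]
    exact dvd_sub (dvd_mul_of_dvd_right (dvd_pow_self P hq0) X) hPP₂
  exact (hcop.pow_right).dvd_of_dvd_mul_left hfinal

/-- A divisor of `X^n - 1` has as many zeros among the powers of a primitive `n`-th root of unity
as its degree says. -/
lemma card_roots_of_dvd_X_pow_sub_one {E : Type*} [Field E] [DecidableEq E] {n : ℕ} {ω : E}
    (hn : 0 < n) (hω : IsPrimitiveRoot ω n) {P : E[X]} (hP : P ∣ X ^ n - 1) :
    (Finset.univ.filter fun i : Fin n => P.eval (ω ^ (i : ℕ)) = 0).card = P.natDegree := by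
  have hne : (X ^ n - 1 : E[X]) ≠ 0 := (monic_X_pow_sub_C (1 : E) hn.ne').ne_zero
  have hP0 : P ≠ 0 := ne_zero_of_dvd_ne_zero hne hP
  have hsplit : (X ^ n - 1 : E[X]).Splits :=
    X_pow_sub_one_splits hω
  have hPs : P.Splits := hsplit.of_dvd hne hP
  have hroots : P.roots ≤ nthRoots n (1 : E) := by
    have := roots.le_of_dvd hne hP
    simpa [nthRoots] using this
  have hnodup : P.roots.Nodup := Multiset.nodup_of_le hroots hω.nthRoots_one_nodup
  rw [hPs.natDegree_eq_card_roots, ← Multiset.toFinset_card_of_nodup hnodup]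
  refine Finset.card_bij (fun i _ => ω ^ (i : ℕ)) ?_ ?_ ?_
  · intro i hi
    rw [Finset.mem_filter] at hi
    rw [Multiset.mem_toFinset, mem_roots hP0]
    exact hi.2
  · intro i _ j _ hij
    exact Fin.ext (hω.pow_inj i.2 j.2 hij)
  · intro s hs
    rw [Multiset.mem_toFinset] at hs
    have h1 : s ^ n = 1 := (mem_nthRoots hn).mp (Multiset.mem_of_le hroots hs)
    have : NeZero n := ⟨hn.ne'⟩
    obtain ⟨i, hi, rfl⟩ := hω.eq_pow_of_pow_eq_one h1
    exact ⟨⟨i, hi⟩, by simpa using (mem_roots hP0).mp hs, rfl⟩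

end CirclePoly

end ConstacyclicDesign

namespace ConstacyclicDesign

/-! ### Block counts in Steiner systems and inversive planes. -/

section Steiner

variable {α : Type*} [Fintype α] [DecidableEq α]

/-- In a `3`-`(v, k, 1)` design, the number of blocks through a set of at most three points. -/
lemma card_blocks_mul_choose {B : Finset (Finset α)} {k : ℕ} (hk : ∀ Z ∈ B, Z.card = k)
    (hB : ∀ T : Finset α, T.card = 3 → (B.filter (T ⊆ ·)).card = 1) {S : Finset α}
    (hS : S.card ≤ 3) :
    (B.filter (S ⊆ ·)).card * (k - S.card).choose (3 - S.card) =
      (Fintype.card α - S.card).choose (3 - S.card) := by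
  -- Double count of pairs (Z, R): Z is a block through S, and R ⊆ Z \ S completes S to a triple.
  have h := Finset.sum_card_bipartiteAbove_eq_sum_card_bipartiteBelow
    (s := B.filter (S ⊆ ·)) (t := Finset.powersetCard (3 - S.card) Sᶜ) (fun Z R => R ⊆ Z)
  have h1 : ∀ Z ∈ B.filter (S ⊆ ·), ((Finset.powersetCard (3 - S.card) Sᶜ).bipartiteAbove
      (fun Z R => R ⊆ Z) Z).card = (k - S.card).choose (3 - S.card) := by
    intro Z hZ
    rw [Finset.mem_filter] at hZ
    have : (Finset.powersetCard (3 - S.card) Sᶜ).bipartiteAbove (fun Z R => R ⊆ Z) Z =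
        Finset.powersetCard (3 - S.card) (Z \ S) := by
      ext R
      simp only [Finset.bipartiteAbove, Finset.mem_filter, Finset.mem_powersetCard,
        Finset.subset_sdiff, Finset.subset_compl_iff_disjoint_right]
      tauto
    rw [this, Finset.card_powersetCard, Finset.card_sdiff_of_subset hZ.2, hk Z hZ.1]
  have h2 : ∀ R ∈ Finset.powersetCard (3 - S.card) Sᶜ, ((B.filter (S ⊆ ·)).bipartiteBelow
      (fun Z R => R ⊆ Z) R).card = 1 := by
    intro R hR
    rw [Finset.mem_powersetCard, Finset.subset_compl_iff_disjoint_right] at hR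
    rw [← hB (S ∪ R) (by rw [Finset.card_union_of_disjoint hR.1.symm, hR.2]; omega)]
    congr 1
    ext Z
    simp only [Finset.bipartiteBelow, Finset.mem_filter, Finset.union_subset_iff]
    tauto
  rw [Finset.sum_congr rfl h1, Finset.sum_congr rfl h2, Finset.sum_const, Finset.sum_const,
    Finset.card_powersetCard, Finset.card_compl] at h
  simpa using h

/-- Inclusion-exclusion for the number of blocks disjoint from a set. -/
lemma card_filter_disjoint (B : Finset (Finset α)) (T : Finset α) :
    ((B.filter (Disjoint T)).card : ℤ) =
      ∑ t ∈ T.powerset, (-1) ^ t.card * ((B.filter (t ⊆ ·)).card : ℤ) := by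
  have h1 : ∀ Z : Finset α, (if Disjoint T Z then (1 : ℤ) else 0) =
      ∑ t ∈ T.powerset, (-1) ^ t.card * if t ⊆ Z then 1 else 0 := by
    intro Z
    -- Expands the product over i ∈ T of 1 - [i ∈ Z], which is the indicator of disjointness.
    have h := Finset.prod_one_add (f := fun i => -if i ∈ Z then (1 : ℤ) else 0) T
    have hp : ∀ t : Finset α, (∏ i ∈ t, if i ∈ Z then (1 : ℤ) else 0) =
        if t ⊆ Z then 1 else 0 := by
      intro t
      rw [Finset.prod_ite_zero]
      simp [Finset.subset_iff]
    simp only [Finset.prod_neg, hp, ← sub_eq_add_neg] at h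
    rw [← h]
    have hq : ∀ i, 1 - (if i ∈ Z then (1 : ℤ) else 0) = if i ∉ Z then 1 else 0 := by
      intro i
      split_ifs <;> simp_all
    simp only [hq]
    rw [Finset.prod_ite_zero]
    simp [Finset.disjoint_left]
  simp only [Finset.card_filter, Nat.cast_sum, Nat.cast_ite, Nat.cast_one, Nat.cast_zero, h1,
    Finset.mul_sum]
  exact Finset.sum_comm

lemma cast_choose_three (n : ℕ) : (n.choose 3 : ℚ) = n * (n - 1) * (n - 2) / 6 := by
  induction n with
  | zero => simp
  | succ n ih =>
    rw [Nat.choose_succ_succ' n 2, Nat.cast_add, ih, Nat.cast_choose_two]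
    push_cast
    ring

/-- In a `3`-`(q²+1, q+1, 1)` design, the number of blocks through a set of at most three
points. -/
lemma card_blocks_of_inversivePlane {B : Finset (Finset α)} {q : ℕ} (hq : 2 < q)
    (hα : Fintype.card α = q ^ 2 + 1) (hk : ∀ Z ∈ B, Z.card = q + 1)
    (hB : ∀ T : Finset α, T.card = 3 → (B.filter (T ⊆ ·)).card = 1) (S : Finset α) :
    (S.card = 0 → (B.filter (S ⊆ ·)).card = q ^ 3 + q) ∧
    (S.card = 1 → (B.filter (S ⊆ ·)).card = q ^ 2 + q) ∧
    (S.card = 2 → (B.filter (S ⊆ ·)).card = q + 1) := by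
  have hq' : (2 : ℚ) < q := by exact_mod_cast hq
  refine ⟨fun hS => ?_, fun hS => ?_, fun hS => ?_⟩
  · have h := card_blocks_mul_choose hk hB (S := S) (by omega)
    rw [hS, hα, Nat.sub_zero, Nat.sub_zero, Nat.sub_zero] at h
    have h' : ((B.filter (S ⊆ ·)).card : ℚ) * ((q + 1).choose 3 : ℕ) =
      ((q ^ 2 + 1).choose 3 : ℕ) := by exact_mod_cast h
    rw [cast_choose_three, cast_choose_three] at h'
    push_cast at h'
    have h0 : ((q : ℚ) + 1) * q * (q - 1) ≠ 0 := by
      have : (q : ℚ) - 1 ≠ 0 := by linarith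
      positivity
    have : ((B.filter (S ⊆ ·)).card : ℚ) = q ^ 3 + q := by
      apply mul_right_cancel₀ h0
      linear_combination 6 * h'
    exact_mod_cast this
  · have h := card_blocks_mul_choose hk hB (S := S) (by omega)
    rw [hS, hα, Nat.add_sub_cancel, Nat.add_sub_cancel] at h
    have h' : ((B.filter (S ⊆ ·)).card : ℚ) * (q.choose 2 : ℕ) =
      ((q ^ 2).choose 2 : ℕ) := by exact_mod_cast h
    rw [Nat.cast_choose_two, Nat.cast_choose_two] at h'
    push_cast at h'
    have h0 : (q : ℚ) * (q - 1) ≠ 0 := by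
      have : (q : ℚ) - 1 ≠ 0 := by linarith
      positivity
    have : ((B.filter (S ⊆ ·)).card : ℚ) = q ^ 2 + q := by
      apply mul_right_cancel₀ h0
      linear_combination 2 * h'
    exact_mod_cast this
  · have h := card_blocks_mul_choose hk hB (S := S) (by omega)
    rw [hS, hα, show 3 - 2 = 1 from rfl, Nat.choose_one_right, Nat.choose_one_right] at h
    obtain ⟨k, rfl⟩ : ∃ k, q = k + 1 := ⟨q - 1, by omega⟩
    have e1 : k + 1 + 1 - 2 = k := by omega
    have e2 : (k + 1) ^ 2 + 1 - 2 = (k + 1 + 1) * k := by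
      have : (k + 1) ^ 2 + 1 = (k + 1 + 1) * k + 2 := by ring
      omega
    rw [e1, e2] at h
    exact Nat.eq_of_mul_eq_mul_right (by omega) h

/-- In a `3`-`(q²+1, q+1, 1)` design, the number of blocks missing three given points. -/
lemma card_blocks_disjoint_of_inversivePlane {B : Finset (Finset α)} {q : ℕ} (hq : 2 < q)
    (hα : Fintype.card α = q ^ 2 + 1) (hk : ∀ Z ∈ B, Z.card = q + 1)
    (hB : ∀ T : Finset α, T.card = 3 → (B.filter (T ⊆ ·)).card = 1) {T : Finset α}
    (hT : T.card = 3) :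
    (B.filter (Disjoint T)).card = (q ^ 2 - q - 1) * (q - 2) := by
  -- The number of blocks through j points, for j ≤ 3; the alternating sum is (q³ + q) - 3(q² + q) +
  -- 3(q + 1) - 1.
  let ρ : ℕ → ℤ := fun j => if j = 0 then (q : ℤ) ^ 3 + q else if j = 1 then (q : ℤ) ^ 2 + q
    else if j = 2 then q + 1 else 1
  have h := card_filter_disjoint B T
  have hρ : ∀ t ∈ T.powerset, (-1 : ℤ) ^ t.card * ((B.filter (t ⊆ ·)).card : ℤ) =
      (fun j => (-1) ^ j * ρ j) t.card := by
    intro t ht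
    have hle : t.card ≤ 3 := hT ▸ Finset.card_le_card (Finset.mem_powerset.mp ht)
    obtain ⟨h0, h1, h2⟩ := card_blocks_of_inversivePlane hq hα hk hB t
    have h3 := hB t
    simp only
    congr 1
    interval_cases hc : t.card
    · rw [h0 rfl]; simp [ρ]
    · rw [h1 rfl]; simp [ρ]
    · rw [h2 rfl]; simp [ρ]
    · rw [h3 rfl]; simp [ρ]
  rw [Finset.sum_congr rfl hρ, Finset.sum_powerset_apply_card (fun j => (-1) ^ j * ρ j), hT] at h
  simp [Finset.sum_range_succ, ρ, Nat.choose] at h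
  have e1 : ((q ^ 2 - q - 1 : ℕ) : ℤ) = q ^ 2 - q - 1 := by
    have : q + 1 ≤ q ^ 2 := by nlinarith
    rw [Nat.sub_sub, Nat.cast_sub this]
    push_cast
    ring
  have e2 : ((q - 2 : ℕ) : ℤ) = q - 2 := by
    rw [Nat.cast_sub hq.le]
    rfl
  have : ((B.filter (Disjoint T)).card : ℤ) = (q ^ 2 - q - 1 : ℕ) * (q - 2 : ℕ) := by
    rw [e1, e2, h]
    ring
  exact_mod_cast this

end Steiner

end ConstacyclicDesign

namespace ConstacyclicDesign

open Polynomial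

/-! ### Zero sets and weights of ovoid codes. -/

section OvoidCodes

variable {F : Type*} [Field F] {n : ℕ}

open Classical in
/-- The set of positions where a vector vanishes. -/
noncomputable def zeroSet (c : Fin n → F) : Finset (Fin n) :=
  Finset.univ.filter fun i => c i = 0

lemma mem_zeroSet {c : Fin n → F} {i : Fin n} : i ∈ zeroSet c ↔ c i = 0 := by
  simp [zeroSet]

lemma supp_eq_compl_zeroSet (c : Fin n → F) : supp c = (zeroSet c)ᶜ := by
  ext i
  simp [supp, mem_zeroSet]

open Classical in
lemma card_supp (c : Fin n → F) : (supp c).card = hammingNorm c := rfl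

open Classical in
lemma hammingNorm_add_card_zeroSet (c : Fin n → F) :
    hammingNorm c + (zeroSet c).card = n := by
  rw [← card_supp, supp_eq_compl_zeroSet, Finset.card_compl_add_card, Fintype.card_fin]

lemma zeroSet_smul {a : F} (ha : a ≠ 0) (c : Fin n → F) : zeroSet (a • c) = zeroSet c := by
  ext i
  simp [mem_zeroSet, ha]

/-- The subcode of `D` of all words vanishing on `S`. -/
def vanishing (D : Submodule F (Fin n → F)) (S : Finset (Fin n)) : Submodule F (Fin n → F) where
  carrier := {c | c ∈ D ∧ ∀ i ∈ S, c i = 0}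
  add_mem' := fun hx hy => ⟨D.add_mem hx.1 hy.1, fun i hi => by simp [hx.2 i hi, hy.2 i hi]⟩
  zero_mem' := ⟨D.zero_mem, fun _ _ => rfl⟩
  smul_mem' := fun a _ hx => ⟨D.smul_mem a hx.1, fun i hi => by simp [hx.2 i hi]⟩

lemma mem_vanishing {D : Submodule F (Fin n → F)} {S : Finset (Fin n)} {c : Fin n → F} :
    c ∈ vanishing D S ↔ c ∈ D ∧ S ⊆ zeroSet c := by
  simp only [Finset.subset_iff, mem_zeroSet]
  rfl

lemma vanishing_empty (D : Submodule F (Fin n → F)) : vanishing D ∅ = D := by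
  ext c
  simp [mem_vanishing]

/-- Vanishing at one more position lowers the dimension by one, unless it is automatic. -/
lemma finrank_vanishing_insert {D : Submodule F (Fin n → F)} {S : Finset (Fin n)} {k : Fin n}
    {c : Fin n → F} (hc : c ∈ vanishing D S) (hk : c k ≠ 0) :
    Module.finrank F (vanishing D (insert k S)) + 1 = Module.finrank F (vanishing D S) := by
  let f : vanishing D S →ₗ[F] F := (LinearMap.proj k).domRestrict (vanishing D S)
  have hf : Function.Surjective f := by
    intro a
    refine ⟨(a * (c k)⁻¹) • ⟨c, hc⟩, ?_⟩
    simp [f, hk]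
  have h := LinearMap.finrank_range_add_finrank_ker f
  rw [LinearMap.range_eq_top.mpr hf, finrank_top, Module.finrank_self] at h
  have h2 : (LinearMap.ker f).map (vanishing D S).subtype = vanishing D (insert k S) := by
    ext x
    simp only [Submodule.mem_map, LinearMap.mem_ker, Submodule.coe_subtype, Subtype.exists,
      exists_and_right, exists_eq_right, mem_vanishing, Finset.insert_subset_iff, mem_zeroSet, f,
      LinearMap.domRestrict_apply, LinearMap.proj_apply]
    constructor
    · rintro ⟨⟨h1, h2⟩, h3⟩
      exact ⟨h1, h3, h2⟩
    · rintro ⟨h1, h3, h2⟩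
      exact ⟨⟨h1, h2⟩, h3⟩
  rw [← h2, Submodule.finrank_map_subtype_eq]
  omega

/-- A code of dimension four whose dual distance is at least four and whose nonzero words with at
least three zeros have exactly `q + 1` zeros. -/
structure IsOvoidCode (q : ℕ) (D : Submodule F (Fin n → F)) : Prop where
  finrank_eq : Module.finrank F D = 4
  exists_ne_zero : ∀ i j k : Fin n, k ≠ i → k ≠ j → ∃ c ∈ D, c i = 0 ∧ c j = 0 ∧ c k ≠ 0
  card_zeroSet : ∀ c ∈ D, c ≠ 0 → 3 ≤ (zeroSet c).card → (zeroSet c).card = q + 1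

namespace IsOvoidCode

variable {q : ℕ} {D : Submodule F (Fin n → F)}

lemma exists_ne_zero_of_card_le_two (hD : IsOvoidCode q D) (hn : 2 ≤ n) {S : Finset (Fin n)}
    (hS : S.card ≤ 2) {k : Fin n} (hk : k ∉ S) : ∃ c ∈ vanishing D S, c k ≠ 0 := by
  -- S is padded to a pair avoiding k; i = j is allowed, and empty S needs a second position, hence
  -- `2 ≤ n`.
  obtain ⟨i, j, hi, hj, hij⟩ : ∃ i j, k ≠ i ∧ k ≠ j ∧ S ⊆ {i, j} := by
    interval_cases h : S.card
    · have : Nontrivial (Fin n) := Fin.nontrivial_iff_two_le.mpr hn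
      obtain ⟨i, hi⟩ := exists_ne k
      refine ⟨i, i, hi.symm, hi.symm, ?_⟩
      rw [Finset.card_eq_zero.mp h]
      exact Finset.empty_subset _
    · obtain ⟨i, rfl⟩ := Finset.card_eq_one.mp h
      have : k ≠ i := by simpa using hk
      exact ⟨i, i, this, this, by simp⟩
    · obtain ⟨i, j, _, rfl⟩ := Finset.card_eq_two.mp h
      have : k ≠ i ∧ k ≠ j := by simpa using hk
      exact ⟨i, j, this.1, this.2, subset_rfl⟩
  obtain ⟨c, hc, h1, h2, h3⟩ := hD.exists_ne_zero i j k hi hj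
  refine ⟨c, mem_vanishing.mpr ⟨hc, hij.trans ?_⟩, h3⟩
  simp [Finset.insert_subset_iff, mem_zeroSet, h1, h2]

lemma finrank_vanishing (hD : IsOvoidCode q D) (hn : 2 ≤ n) {S : Finset (Fin n)}
    (hS : S.card ≤ 3) : Module.finrank F (vanishing D S) = 4 - S.card := by
  induction S using Finset.induction_on with
  | empty => rw [vanishing_empty, hD.finrank_eq, Finset.card_empty]
  | insert k S hk ih =>
    rw [Finset.card_insert_of_notMem hk] at hS ⊢
    obtain ⟨c, hc, hck⟩ := hD.exists_ne_zero_of_card_le_two hn (by omega) hk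
    have := finrank_vanishing_insert hc hck
    rw [ih (by omega)] at this
    omega

/-- Three positions determine a word up to a scalar. -/
lemma exists_generator (hD : IsOvoidCode q D) (hn : 2 ≤ n) {T : Finset (Fin n)}
    (hT : T.card = 3) : ∃ c ∈ D, c ≠ 0 ∧ T ⊆ zeroSet c ∧ (zeroSet c).card = q + 1 ∧
      ∀ x ∈ D, T ⊆ zeroSet x → ∃ a : F, x = a • c := by
  have h := hD.finrank_vanishing hn hT.le
  rw [hT] at h
  obtain ⟨⟨c, hc⟩, hc0, hgen⟩ := finrank_eq_one_iff'.mp h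
  have hc0' : c ≠ 0 := fun h => hc0 (Subtype.ext h)
  rw [mem_vanishing] at hc
  refine ⟨c, hc.1, hc0', hc.2, hD.card_zeroSet c hc.1 hc0' ?_, ?_⟩
  · rw [← hT]
    exact Finset.card_le_card hc.2
  · intro x hx hTx
    obtain ⟨a, ha⟩ := hgen ⟨x, mem_vanishing.mpr ⟨hx, hTx⟩⟩
    exact ⟨a, (congrArg Subtype.val ha).symm⟩

open Classical in
/-- The zero sets with at least three points. -/
noncomputable def circles (D : Submodule F (Fin n → F)) : Finset (Finset (Fin n)) :=
  Finset.univ.filter fun Z => 3 ≤ Z.card ∧ ∃ c ∈ D, c ≠ 0 ∧ zeroSet c = Z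

lemma mem_circles {Z : Finset (Fin n)} :
    Z ∈ circles D ↔ 3 ≤ Z.card ∧ ∃ c ∈ D, c ≠ 0 ∧ zeroSet c = Z := by
  simp [circles]

lemma card_of_mem_circles (hD : IsOvoidCode q D) {Z : Finset (Fin n)} (hZ : Z ∈ circles D) :
    Z.card = q + 1 := by
  obtain ⟨h3, c, hc, hc0, rfl⟩ := mem_circles.mp hZ
  exact hD.card_zeroSet c hc hc0 h3

lemma zeroSet_eq (hD : IsOvoidCode q D) (hn : 2 ≤ n) {T : Finset (Fin n)} (hT : T.card = 3)
    {x y : Fin n → F} (hx : x ∈ D) (hy : y ∈ D) (hx0 : x ≠ 0) (hy0 : y ≠ 0)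
    (hTx : T ⊆ zeroSet x) (hTy : T ⊆ zeroSet y) : zeroSet x = zeroSet y := by
  obtain ⟨c, -, -, -, -, hgen⟩ := hD.exists_generator hn hT
  obtain ⟨a, rfl⟩ := hgen x hx hTx
  obtain ⟨b, rfl⟩ := hgen y hy hTy
  rw [zeroSet_smul, zeroSet_smul]
  · rintro rfl
    simp at hy0
  · rintro rfl
    simp at hx0

lemma card_circles_through (hD : IsOvoidCode q D) (hn : 2 ≤ n) {T : Finset (Fin n)}
    (hT : T.card = 3) : ((circles D).filter (T ⊆ ·)).card = 1 := by
  obtain ⟨c, hc, hc0, hTc, hcard, -⟩ := hD.exists_generator hn hT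
  rw [Finset.card_eq_one]
  refine ⟨zeroSet c, ?_⟩
  ext Z
  rw [Finset.mem_filter, Finset.mem_singleton, mem_circles]
  constructor
  · rintro ⟨⟨-, x, hx, hx0, rfl⟩, hTx⟩
    exact hD.zeroSet_eq hn hT hx hc hx0 hc0 hTx hTc
  · rintro rfl
    exact ⟨⟨hT ▸ Finset.card_le_card hTc, c, hc, hc0, rfl⟩, hTc⟩

/-! ### Weight distribution -/

variable [Fintype F]

open Classical in
/-- Counting pairs of a word and a `j`-set of its zeros. -/
lemma sum_choose_card_zeroSet (hD : IsOvoidCode q D) (hn : 2 ≤ n) {j : ℕ} (hj : j ≤ 3) :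
    ∑ c ∈ Finset.univ.filter (· ∈ D), (zeroSet c).card.choose j =
      n.choose j * Fintype.card F ^ (4 - j) := by
  have h := Finset.sum_card_bipartiteAbove_eq_sum_card_bipartiteBelow
    (s := Finset.univ.filter (· ∈ D)) (t := Finset.powersetCard j (Finset.univ : Finset (Fin n)))
    (fun c S => S ⊆ zeroSet c)
  have h1 : ∀ c : Fin n → F, ((Finset.powersetCard j Finset.univ).bipartiteAbove
      (fun c S => S ⊆ zeroSet c) c).card = (zeroSet c).card.choose j := by
    intro c
    rw [← Finset.card_powersetCard]
    congr 1
    ext S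
    simp [Finset.bipartiteAbove, Finset.mem_powersetCard, and_comm]
  have h2 : ∀ S ∈ Finset.powersetCard j (Finset.univ : Finset (Fin n)),
      ((Finset.univ.filter (· ∈ D)).bipartiteBelow (fun c S => S ⊆ zeroSet c) S).card =
        Fintype.card F ^ (4 - j) := by
    intro S hS
    rw [Finset.mem_powersetCard] at hS
    -- Vanishing on a set of j ≤ 3 positions imposes j independent conditions.
    rw [← hS.2, ← hD.finrank_vanishing hn (hS.2 ▸ hj), ← Module.card_eq_pow_finrank,
      Fintype.card_subtype]
    congr 1
    ext c
    simp [Finset.bipartiteBelow, mem_vanishing]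
  simp only [h1] at h
  rw [h, Finset.sum_congr rfl h2, Finset.sum_const, Finset.card_powersetCard, Finset.card_fin,
    smul_eq_mul]

open Classical in
/-- The number of nonzero words with exactly `z` zeros. -/
noncomputable def zeroCount (D : Submodule F (Fin n → F)) (z : ℕ) : ℕ :=
  (Finset.univ.filter fun c : Fin n → F => (c ∈ D ∧ c ≠ 0) ∧ (zeroSet c).card = z).card

open Classical in
lemma sum_zeroSet (hD : IsOvoidCode q D) (hq : 2 < q) {R : Type*} [CommSemiring R]
    (f : ℕ → R) :
    ∑ c ∈ Finset.univ.filter (· ∈ D), f (zeroSet c).card =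
      f n + (zeroCount D 0 * f 0 + zeroCount D 1 * f 1 + zeroCount D 2 * f 2
        + zeroCount D (q + 1) * f (q + 1)) := by
  have h0 : Finset.univ.filter (· ∈ D) =
      insert 0 (Finset.univ.filter fun c : Fin n → F => c ∈ D ∧ c ≠ 0) := by
    ext c
    by_cases hc : c = 0
    · simp [hc, D.zero_mem]
    · simp [hc]
  have hz : (zeroSet (0 : Fin n → F)).card = n := by
    simp [zeroSet]
  rw [h0, Finset.sum_insert (by simp), hz]
  congr 1
  have hmaps : ∀ c ∈ Finset.univ.filter (fun c : Fin n → F => c ∈ D ∧ c ≠ 0),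
      (zeroSet c).card ∈ ({0, 1, 2, q + 1} : Finset ℕ) := by
    intro c hc
    rw [Finset.mem_filter] at hc
    have := hD.card_zeroSet c hc.2.1 hc.2.2
    simp only [Finset.mem_insert, Finset.mem_singleton]
    omega
  rw [← Finset.sum_fiberwise_of_maps_to hmaps]
  have hfib : ∀ z, ∑ c ∈ (Finset.univ.filter (fun c : Fin n → F => c ∈ D ∧ c ≠ 0)).filter
      (fun c => (zeroSet c).card = z), f (zeroSet c).card = zeroCount D z * f z := by
    intro z
    rw [Finset.sum_congr rfl (g := fun _ => f z), Finset.sum_const, Finset.filter_filter,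
      nsmul_eq_mul, zeroCount]
    intro c hc
    rw [(Finset.mem_filter.mp hc).2]
  simp only [hfib]
  rw [Finset.sum_insert (by simp), Finset.sum_insert (by simp; omega),
    Finset.sum_insert (by simp; omega), Finset.sum_singleton]
  ring

/-- The weight distribution, as solution of the equations for the first four power moments. -/
lemma zeroCount_eq (hD : IsOvoidCode q D) (hq : 2 < q) (hn : n = q ^ 2 + 1)
    (hF : Fintype.card F = q ^ 2) :
    (zeroCount D (q + 1) : ℚ) = q ^ 5 - q ∧
    (zeroCount D 2 : ℚ) = (q ^ 4 - 1) * (q - 1) * q ^ 3 / 2 ∧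
    (zeroCount D 1 : ℚ) = q ^ 7 - q ^ 5 + q ^ 4 - q ^ 3 + q - 1 ∧
    (zeroCount D 0 : ℚ) = (q ^ 4 - 1) * (q - 1) * q ^ 3 / 2 := by
  have hn2 : 2 ≤ n := by
    rw [hn]
    nlinarith
  have key : ∀ j ≤ 3, (n.choose j : ℚ) + (zeroCount D 0 * (Nat.choose 0 j : ℚ)
      + zeroCount D 1 * (Nat.choose 1 j : ℚ) + zeroCount D 2 * (Nat.choose 2 j : ℚ)
      + zeroCount D (q + 1) * ((q + 1).choose j : ℚ)) = n.choose j * (q ^ 2) ^ (4 - j) := by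
    intro j hj
    rw [← hD.sum_zeroSet hq (fun z => (z.choose j : ℚ)), ← Nat.cast_sum,
      hD.sum_choose_card_zeroSet hn2 hj, hF]
    push_cast
    ring
  have k0 := key 0 (by omega)
  have k1 := key 1 (by omega)
  have k2 := key 2 (by omega)
  have k3 := key 3 (by omega)
  simp only [Nat.choose_zero_right, Nat.choose_one_right, Nat.cast_choose_two,
    cast_choose_three, hn] at k0 k1 k2 k3
  push_cast at k0 k1 k2 k3
  have hq' : (2 : ℚ) < q := by exact_mod_cast hq
  -- The system is triangular: only words with q+1 zeros, besides the zero word, enter the third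
  -- moment, since z choose 3 is 0 for z ≤ 2.
  have e3 : (zeroCount D (q + 1) : ℚ) = q ^ 5 - q := by
    have h0 : ((q : ℚ) + 1) * q * (q - 1) ≠ 0 := by
      have : (q : ℚ) - 1 ≠ 0 := by linarith
      positivity
    apply mul_right_cancel₀ h0
    linear_combination 6 * k3
  have e2 : (zeroCount D 2 : ℚ) = (q ^ 4 - 1) * (q - 1) * q ^ 3 / 2 := by
    linear_combination k2 - ((q : ℚ) + 1) * q / 2 * e3
  have e1 : (zeroCount D 1 : ℚ) = q ^ 7 - q ^ 5 + q ^ 4 - q ^ 3 + q - 1 := by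
    linear_combination k1 - ((q : ℚ) + 1) * e3 - 2 * e2
  refine ⟨e3, e2, e1, ?_⟩
  linear_combination k0 - e1 - e2 - e3

open Classical in
lemma weightEnumerator_eq_sum (D : Submodule F (Fin n → F)) :
    weightEnumerator D = ∑ c ∈ Finset.univ.filter (· ∈ D), X ^ (n - (zeroSet c).card) := by
  have hmaps : ∀ c ∈ Finset.univ.filter (· ∈ D), hammingNorm c ∈ Finset.range (n + 1) := by
    intro c _
    have := hammingNorm_add_card_zeroSet c
    rw [Finset.mem_range]
    omega
  rw [← Finset.sum_fiberwise_of_maps_to hmaps, weightEnumerator]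
  refine Finset.sum_congr rfl fun w _ => ?_
  rw [Finset.sum_congr rfl (g := fun _ => X ^ w), Finset.sum_const, Finset.filter_filter,
    weightCount, Set.ncard_eq_toFinset_card', Set.toFinset_ofPred]
  · simp
  · intro c hc
    have := hammingNorm_add_card_zeroSet c
    rw [← (Finset.mem_filter.mp hc).2]
    congr 1
    omega

lemma weightEnumerator_eq (hD : IsOvoidCode q D) (hq : 2 < q) (hn : n = q ^ 2 + 1)
    (hF : Fintype.card F = q ^ 2) :
    weightEnumerator D = 1 + C ((q : ℚ) ^ 5 - q) * X ^ (q ^ 2 - q)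
        + C (((q : ℚ) ^ 4 - 1) * (q - 1) * q ^ 3 / 2) * (X ^ (q ^ 2 - 1) + X ^ (q ^ 2 + 1))
        + C ((q : ℚ) ^ 7 - q ^ 5 + q ^ 4 - q ^ 3 + q - 1) * X ^ (q ^ 2) := by
  obtain ⟨e3, e2, e1, e0⟩ := hD.zeroCount_eq hq hn hF
  rw [weightEnumerator_eq_sum, hD.sum_zeroSet hq (fun z => (X : ℚ[X]) ^ (n - z))]
  rw [← e3, ← e1]
  nth_rw 1 [mul_add]
  nth_rw 1 [← e2]
  rw [← e0]
  subst hn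
  have s1 : q ^ 2 + 1 - (q + 1) = q ^ 2 - q := by omega
  have s2 : q ^ 2 + 1 - 2 = q ^ 2 - 1 := by omega
  simp only [s1, s2, Nat.sub_self, Nat.sub_zero, Nat.add_sub_cancel, pow_zero, map_natCast]
  ring

end IsOvoidCode

end OvoidCodes

end ConstacyclicDesign

namespace ConstacyclicDesign

/-! ### Parameters and designs of an ovoid code and of its dual. -/

section OvoidCodes

variable {F : Type*} [Field F] {n : ℕ}

open Classical in
/-- The minimum distance of a code is its minimum nonzero weight. -/
lemma isLeast_hammingDist {D : Submodule F (Fin n → F)} {d : ℕ}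
    (hex : ∃ c ∈ D, c ≠ 0 ∧ hammingNorm c = d) (hle : ∀ c ∈ D, c ≠ 0 → d ≤ hammingNorm c) :
    IsLeast {w : ℕ | ∃ x ∈ D, ∃ y ∈ D, x ≠ y ∧ hammingDist x y = w} d := by
  refine ⟨?_, ?_⟩
  · obtain ⟨c, hc, hc0, h⟩ := hex
    exact ⟨c, hc, 0, D.zero_mem, hc0, by rw [hammingDist_zero_right, h]⟩
  · rintro w ⟨x, hx, y, hy, hxy, rfl⟩
    rw [hammingDist_eq_hammingNorm]
    exact hle _ (by simpa [neg_add_eq_sub] using D.sub_mem hy hx)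
      (by rw [neg_add_eq_sub]; exact sub_ne_zero.mpr hxy.symm)

lemma mem_dualCode {D : Submodule F (Fin n → F)} {x : Fin n → F} :
    x ∈ dualCode D ↔ ∀ c ∈ D, ∑ i, c i * x i = 0 := Iff.rfl

lemma finrank_dualCode (D : Submodule F (Fin n → F)) :
    Module.finrank F (dualCode D) = n - Module.finrank F D := by
  have hnd : (Matrix.toBilin' (1 : Matrix (Fin n) (Fin n) F)).Nondegenerate :=
    LinearMap.BilinForm.nondegenerate_toBilin'_of_det_ne_zero' _ (by simp)
  have h := LinearMap.BilinForm.finrank_orthogonal hnd D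
  rw [Module.finrank_fin_fun] at h
  suffices hD : dualCode D = (Matrix.toBilin' 1).orthogonal D by rw [hD, h]
  ext x
  rw [mem_dualCode, LinearMap.BilinForm.mem_orthogonal_iff]
  refine forall₂_congr fun c _ => ?_
  rw [Matrix.toBilin'_apply']
  simp [dotProduct]

namespace IsOvoidCode

variable {q : ℕ} {D : Submodule F (Fin n → F)}

lemma exists_card_eq_three (hn : 3 ≤ n) : ∃ T : Finset (Fin n), T.card = 3 := by
  obtain ⟨T, -, hT⟩ := Finset.exists_subset_card_eq (s := (Finset.univ : Finset (Fin n)))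
    (n := 3) (by simpa using hn)
  exact ⟨T, hT⟩

open Classical in
lemma hammingNorm_eq_iff (hn : n = q ^ 2 + 1) (c : Fin n → F) :
    hammingNorm c = q ^ 2 - q ↔ (zeroSet c).card = q + 1 := by
  have h1 := hammingNorm_add_card_zeroSet c
  have h2 : q ≤ q ^ 2 := Nat.le_self_pow two_ne_zero q
  omega

theorem hasParameters (hD : IsOvoidCode q D) (hq : 2 < q) (hn : n = q ^ 2 + 1) :
    HasParameters D 4 (q ^ 2 - q) := by
  have hn3 : 3 ≤ n := by
    rw [hn]
    nlinarith
  refine ⟨hD.finrank_eq, isLeast_hammingDist ?_ ?_⟩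
  · obtain ⟨T, hT⟩ := exists_card_eq_three hn3
    obtain ⟨c, hc, hc0, -, h, -⟩ := hD.exists_generator (by omega) hT
    exact ⟨c, hc, hc0, (hammingNorm_eq_iff hn c).mpr h⟩
  · intro c hc hc0
    have h1 := hD.card_zeroSet c hc hc0
    have h2 := hammingNorm_add_card_zeroSet c
    omega

open Classical in
lemma weightCount_ne_zero [Finite F] {D : Submodule F (Fin n → F)} {w : ℕ} {c : Fin n → F}
    (hc : c ∈ D) (hw : hammingNorm c = w) : weightCount D w ≠ 0 := by
  unfold weightCount
  exact Set.ncard_ne_zero_of_mem (a := c) ⟨hc, hw⟩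

open Classical in
theorem supportsDesign [Finite F] (hD : IsOvoidCode q D) (hq : 2 < q) (hn : n = q ^ 2 + 1) :
    SupportsDesign D 3 (q ^ 2 - q) ((q ^ 2 - q - 1) * (q - 2)) := by
  have hn3 : 3 ≤ n := by
    rw [hn]
    nlinarith
  have hq2 : q + 2 ≤ q ^ 2 := by nlinarith
  refine ⟨by norm_num, Nat.mul_pos (by omega) (by omega), by omega, by omega, ?_,
    Fintype.card_fin n, by omega, by omega, ?_, ?_⟩
  · obtain ⟨T, hT⟩ := exists_card_eq_three hn3
    obtain ⟨c, hc, -, -, h, -⟩ := hD.exists_generator (by omega) hT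
    exact weightCount_ne_zero hc ((hammingNorm_eq_iff hn c).mpr h)
  · rintro b ⟨c, -, hw, rfl⟩
    exact hw
  · intro T hT
    -- Complementation matches the supports containing T with the circles missing T.
    rw [← card_blocks_disjoint_of_inversivePlane hq (by rw [Fintype.card_fin, hn])
      (fun Z hZ => hD.card_of_mem_circles hZ)
      (fun T hT => hD.card_circles_through (by omega) hT) hT,
      ← Finset.card_image_of_injective _ compl_injective, ← Set.ncard_coe_finset]
    congr 1
    ext b
    simp only [Set.mem_ofPred_eq, Finset.coe_image, Finset.coe_filter, Set.mem_image,
      supportBlocks, mem_circles]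
    constructor
    · rintro ⟨⟨c, hc, hw, rfl⟩, hT⟩
      have hz := (hammingNorm_eq_iff hn c).mp hw
      have hc0 : c ≠ 0 := by
        rintro rfl
        rw [hammingNorm_zero] at hw
        omega
      rw [supp_eq_compl_zeroSet] at hT ⊢
      exact ⟨zeroSet c, ⟨⟨by omega, c, hc, hc0, rfl⟩,
        Finset.subset_compl_iff_disjoint_right.mp hT⟩, rfl⟩
    · rintro ⟨Z, ⟨⟨h3, c, hc, hc0, rfl⟩, hT⟩, rfl⟩
      exact ⟨⟨c, hc, (hammingNorm_eq_iff hn c).mpr (hD.card_zeroSet c hc hc0 h3),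
        supp_eq_compl_zeroSet c⟩, Finset.subset_compl_iff_disjoint_right.mpr hT⟩

/-! ### The dual code -/

open Classical in
lemma four_le_hammingNorm (hD : IsOvoidCode q D) (hn : 2 ≤ n) {x : Fin n → F}
    (hx : x ∈ dualCode D) (hx0 : x ≠ 0) : 4 ≤ hammingNorm x := by
  by_contra! hlt
  obtain ⟨k, hk⟩ := Function.ne_iff.mp hx0
  have hk' : k ∈ supp x := by simpa [supp] using hk
  -- If the weight were at most 3, some codeword would vanish on the whole support except k, and
  -- pairing it with x would leave one nonzero term.
  obtain ⟨c, hc, hck⟩ := hD.exists_ne_zero_of_card_le_two hn (S := (supp x).erase k) (k := k)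
    (by rw [Finset.card_erase_of_mem hk', card_supp]; omega) (Finset.notMem_erase k _)
  rw [mem_vanishing] at hc
  have h := hx c hc.1
  rw [Finset.sum_eq_single k] at h
  · exact (mul_ne_zero hck hk) h
  · intro i _ hik
    by_cases hi : x i = 0
    · rw [hi, mul_zero]
    · have : i ∈ zeroSet c := hc.2 (Finset.mem_erase.mpr ⟨hik, by simpa [supp] using hi⟩)
      rw [mem_zeroSet.mp this, zero_mul]
  · simp

open Classical in
/-- Four positions lying on a circle support a dual word. -/
lemma exists_dual_word (hD : IsOvoidCode q D) (hn : 2 ≤ n) {T : Finset (Fin n)} (hT : T.card = 3)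
    {k : Fin n} (hk : k ∉ T) (h : ∀ c ∈ D, T ⊆ zeroSet c → c k = 0) :
    ∃ x ∈ dualCode D, hammingNorm x = 4 ∧ supp x = insert k T := by
  let L : Fin n → D →ₗ[F] F := fun i => (LinearMap.proj i).domRestrict D
  -- Evaluation at k kills the common kernel of the evaluations on T, so it is a combination of
  -- them; the coefficients of this relation form the dual word.
  have hspan : L k ∈ Submodule.span F (Set.range fun i : T => L i) := by
    apply mem_span_of_iInf_ker_le_ker
    intro c hc
    rw [Submodule.mem_iInf] at hc
    exact h c c.2 fun i hi => mem_zeroSet.mpr (hc ⟨i, hi⟩)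
  obtain ⟨a, ha⟩ := (Submodule.mem_span_range_iff_exists_fun F).mp hspan
  let x : Fin n → F := fun i => if i = k then -1 else if hi : i ∈ T then a ⟨i, hi⟩ else 0
  have hx : x ∈ dualCode D := by
    intro c hc
    have h1 := LinearMap.congr_fun ha ⟨c, hc⟩
    simp only [LinearMap.coe_sum, Finset.sum_apply, LinearMap.smul_apply, L,
      LinearMap.domRestrict_apply, LinearMap.proj_apply, smul_eq_mul] at h1
    have h2 : ∀ i ∉ insert k T, c i * x i = 0 := by
      intro i hi
      rw [Finset.mem_insert, not_or] at hi
      simp [x, hi]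
    rw [← Finset.sum_subset (Finset.subset_univ (insert k T)) fun i _ hi => h2 i hi,
      Finset.sum_insert hk, ← Finset.sum_coe_sort T]
    have h3 : ∀ i : T, c i * x i = a i * c i := by
      intro i
      have : (i : Fin n) ≠ k := fun h => hk (h ▸ i.2)
      simp [x, this, mul_comm]
    rw [Finset.sum_congr rfl fun i _ => h3 i, h1]
    simp [x]
  have hx0 : x ≠ 0 := by
    intro h0
    have := congrFun h0 k
    simp [x] at this
  have hsub : supp x ⊆ insert k T := by
    intro i hi
    by_contra hi'
    rw [Finset.mem_insert, not_or] at hi'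
    simp [supp, x, hi'] at hi
  have h4 := hD.four_le_hammingNorm hn hx hx0
  have hcard : (insert k T).card = 4 := by rw [Finset.card_insert_of_notMem hk, hT]
  -- Dual distance four leaves no room for a zero coefficient.
  have heq : supp x = insert k T := Finset.eq_of_subset_of_card_le hsub (by rw [hcard]; exact h4)
  exact ⟨x, hx, by rw [← card_supp, heq, hcard], heq⟩

open Classical in
/-- The supports of weight four in the dual that contain three given positions. -/
lemma supportBlocks_dualCode_through (hD : IsOvoidCode q D) (hn : 2 ≤ n) {T : Finset (Fin n)}
    (hT : T.card = 3) : ∃ R : Finset (Fin n), R.card = q - 2 ∧ Disjoint R T ∧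
      {b ∈ supportBlocks (dualCode D) 4 | T ⊆ b} = (R.image (insert · T) : Set (Finset (Fin n))) := by
  obtain ⟨c, hc, hc0, hTc, hcard, hgen⟩ := hD.exists_generator hn hT
  -- The fourth position ranges over the other (q + 1) - 3 points of the circle through T.
  refine ⟨zeroSet c \ T, ?_, Finset.sdiff_disjoint, ?_⟩
  · rw [Finset.card_sdiff_of_subset hTc, hcard, hT]
    omega
  ext b
  simp only [Finset.coe_image, Finset.coe_sdiff, Set.mem_image, Set.mem_sdiff, Finset.mem_coe,
    supportBlocks, Set.mem_ofPred_eq]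
  constructor
  · rintro ⟨⟨x, hx, hw, rfl⟩, hTx⟩
    have hw' : (supp x).card = 4 := hw
    obtain ⟨k, hk⟩ : ∃ k, supp x \ T = {k} := by
      rw [← Finset.card_eq_one, Finset.card_sdiff_of_subset hTx, hw', hT]
    have hkx : k ∈ supp x \ T := hk ▸ Finset.mem_singleton_self k
    rw [Finset.mem_sdiff] at hkx
    have heq : insert k T = supp x := by
      rw [← Finset.sdiff_union_of_subset hTx, hk, Finset.insert_eq]
    refine ⟨k, ⟨?_, hkx.2⟩, heq⟩
    have h := hx c hc
    rw [Finset.sum_eq_single k] at h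
    · rw [mem_zeroSet]
      exact (mul_eq_zero.mp h).resolve_right (by simpa [supp] using hkx.1)
    · intro i _ hik
      by_cases hi : x i = 0
      · rw [hi, mul_zero]
      · have hi' : i ∈ insert k T := by
          rw [heq]
          simpa [supp] using hi
        rw [mem_zeroSet.mp (hTc (Finset.mem_of_mem_insert_of_ne hi' hik)), zero_mul]
    · simp
  · rintro ⟨k, ⟨hkc, hkT⟩, rfl⟩
    obtain ⟨x, hx, hw, heq⟩ := hD.exists_dual_word hn hT hkT fun y hy hTy => by
      obtain ⟨a, rfl⟩ := hgen y hy hTy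
      simp [mem_zeroSet.mp hkc]
    exact ⟨⟨x, hx, hw, heq⟩, Finset.subset_insert k T⟩

open Classical in
lemma exists_dual_word_of_two_lt (hD : IsOvoidCode q D) (hq : 2 < q) (hn : 3 ≤ n) :
    ∃ x ∈ dualCode D, hammingNorm x = 4 := by
  obtain ⟨T, hT⟩ := exists_card_eq_three hn
  obtain ⟨R, hR, -, h⟩ := hD.supportBlocks_dualCode_through (by omega) hT
  obtain ⟨k, hk⟩ : R.Nonempty := Finset.card_pos.mp (by omega)
  have : insert k T ∈ {b ∈ supportBlocks (dualCode D) 4 | T ⊆ b} := by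
    rw [h]
    exact Finset.mem_coe.mpr (Finset.mem_image_of_mem _ hk)
  obtain ⟨⟨x, hx, hw, -⟩, -⟩ := this
  exact ⟨x, hx, hw⟩

theorem hasParameters_dualCode (hD : IsOvoidCode q D) (hq : 2 < q) (hn : n = q ^ 2 + 1) :
    HasParameters (dualCode D) (q ^ 2 - 3) 4 := by
  have hn3 : 3 ≤ n := by
    rw [hn]
    nlinarith
  refine ⟨?_, isLeast_hammingDist ?_ ?_⟩
  · rw [finrank_dualCode, hD.finrank_eq, hn]
    omega
  · obtain ⟨x, hx, hw⟩ := hD.exists_dual_word_of_two_lt hq hn3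
    refine ⟨x, hx, ?_, hw⟩
    rintro rfl
    simp at hw
  · exact fun c hc hc0 => hD.four_le_hammingNorm (by omega) hc hc0

open Classical in
theorem supportsDesign_dualCode [Finite F] (hD : IsOvoidCode q D) (hq : 2 < q)
    (hn : n = q ^ 2 + 1) : SupportsDesign (dualCode D) 3 4 (q - 2) := by
  have hn4 : 4 ≤ n := by
    rw [hn]
    nlinarith
  refine ⟨by norm_num, by omega, by norm_num, hn4, ?_, Fintype.card_fin n, by norm_num, hn4, ?_, ?_⟩
  · obtain ⟨x, hx, hw⟩ := hD.exists_dual_word_of_two_lt hq (by omega)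
    exact weightCount_ne_zero hx hw
  · rintro b ⟨c, -, hw, rfl⟩
    exact hw
  · intro T hT
    obtain ⟨R, hR, hdisj, h⟩ := hD.supportBlocks_dualCode_through (by omega) hT
    rw [h, Set.ncard_coe_finset, Finset.card_image_of_injOn, hR]
    intro k hk l _ hkl
    have hk' : k ∉ T := Finset.disjoint_left.mp hdisj hk
    have : k ∈ insert l T := by
      rw [← show insert k T = insert l T from hkl]
      exact Finset.mem_insert_self k T
    exact (Finset.mem_insert.mp this).resolve_right hk'

end IsOvoidCode

end OvoidCodes

end ConstacyclicDesign

namespace ConstacyclicDesign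

open Polynomial

/-! ### Trace words and their zeros. -/

section TraceWords

variable {F E : Type*} [Field F] [Field E] [Algebra F E] {q : ℕ}

/-- The word with entries `Tr(a x + b x^q)`, where `x` runs through the first `n` powers
of `ε`. -/
noncomputable def traceWord (F : Type*) {E : Type*} [Field F] [Field E] [Algebra F E]
    (q n : ℕ) (ε : E) : E × E →ₗ[F] (Fin n → F) where
  toFun v i := Algebra.trace F E (v.1 * ε ^ (i : ℕ) + v.2 * (ε ^ (i : ℕ)) ^ q)
  map_add' v w := by
    ext i
    rw [Pi.add_apply, ← map_add]
    congr 1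
    simp only [Prod.fst_add, Prod.snd_add]
    ring
  map_smul' a v := by
    ext i
    rw [Pi.smul_apply, RingHom.id_apply, ← map_smul]
    congr 1
    simp only [Prod.smul_fst, Prod.smul_snd, smul_add, smul_mul_assoc]

lemma traceWord_apply (n : ℕ) (ε : E) (v : E × E) (i : Fin n) :
    traceWord F q n ε v i =
      Algebra.trace F E (v.1 * ε ^ (i : ℕ) + v.2 * (ε ^ (i : ℕ)) ^ q) := rfl

/-- With s = x^{q-1}, these rewrite the conjugates of x as x times monomials in s. The middle
identity uses q³ - (q² - q + 1) = (q - 1)(q² + 1). -/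
lemma pow_mul_pow {x : E} (hq1 : 1 ≤ q) (hx : x ^ ((q - 1) * (q ^ 2 + 1)) = 1) :
    x * (x ^ (q - 1)) ^ (q + 1) = x ^ q ^ 2 ∧ x * (x ^ (q - 1)) ^ q = x ^ q ^ 3 ∧
      x * x ^ (q - 1) = x ^ q := by
  obtain ⟨k, rfl⟩ : ∃ k, q = k + 1 := ⟨q - 1, by omega⟩
  rw [Nat.add_sub_cancel] at *
  refine ⟨by ring, ?_, by ring⟩
  calc x * (x ^ k) ^ (k + 1) = x * (x ^ k) ^ (k + 1) * x ^ (k * ((k + 1) ^ 2 + 1)) := by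
        rw [hx, mul_one]
    _ = x ^ (k + 1) ^ 3 := by ring

lemma pow_pow_eq_one {ε : E} (hε : ε ^ ((q - 1) * (q ^ 2 + 1)) = 1) (i : ℕ) :
    (ε ^ i) ^ ((q - 1) * (q ^ 2 + 1)) = 1 := by
  rw [← pow_mul, mul_comm, pow_mul, hε, one_pow]

variable [Finite E]

lemma algebraMap_trace_eq (hF : Nat.card F = q ^ 2) (hE : Module.finrank F E = 2) (y : E) :
    algebraMap F E (Algebra.trace F E y) = y + y ^ q ^ 2 := by
  rw [FiniteField.algebraMap_trace_eq_sum_pow, hE, hF]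
  simp [Finset.sum_range_succ]

lemma pow_q_pow_four (hE : Nat.card E = q ^ 4) (y : E) : y ^ q ^ 4 = y := by
  have := Fintype.ofFinite E
  rw [← hE, Nat.card_eq_fintype_card, FiniteField.pow_card]

lemma trace_pow (hF : Nat.card F = q ^ 2) (hE : Module.finrank F E = 2)
    (hE' : Nat.card E = q ^ 4) (y : E) :
    Algebra.trace F E (y ^ q ^ 2) = Algebra.trace F E y := by
  apply (algebraMap F E).injective
  rw [algebraMap_trace_eq hF hE, algebraMap_trace_eq hF hE, ← pow_mul, ← pow_add,
    pow_q_pow_four hE', add_comm]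

variable (p m : ℕ) [Fact p.Prime] [CharP E p]

lemma algebraMap_traceWord (hq : q = p ^ m) (hF : Nat.card F = q ^ 2)
    (hE : Module.finrank F E = 2) (n : ℕ) (ε a b : E) (i : Fin n) :
    algebraMap F E (traceWord F q n ε (a, b) i) = a * ε ^ (i : ℕ)
      + b * (ε ^ (i : ℕ)) ^ q + a ^ q ^ 2 * (ε ^ (i : ℕ)) ^ q ^ 2
      + b ^ q ^ 2 * (ε ^ (i : ℕ)) ^ q ^ 3 := by
  rw [traceWord_apply, algebraMap_trace_eq hF hE]
  have h : q ^ 2 = p ^ (m * 2) := by rw [hq, pow_mul]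
  conv_lhs => rw [h, add_pow_char_pow, ← h]
  simp only
  ring

lemma algebraMap_traceWord_eq_eval (hq : q = p ^ m) (hq1 : 1 ≤ q) (hF : Nat.card F = q ^ 2)
    (hE : Module.finrank F E = 2) {ε : E} (hε : ε ^ ((q - 1) * (q ^ 2 + 1)) = 1) (n : ℕ)
    (a b : E) (i : Fin n) :
    algebraMap F E (traceWord F q n ε (a, b) i) = ε ^ (i : ℕ) *
      (circlePoly q a b (a ^ q ^ 2) (b ^ q ^ 2)).eval ((ε ^ (q - 1)) ^ (i : ℕ)) := by
  obtain ⟨h1, h2, h3⟩ := pow_mul_pow hq1 (pow_pow_eq_one hε i)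
  rw [algebraMap_traceWord p m hq hF hE, eval_circlePoly, pow_right_comm ε (q - 1) (i : ℕ),
    ← h1, ← h2, ← h3]
  ring

variable {p m} in
-- With u and t the values of s at i and j, the expression x(s - u)(s - t)^q vanishes at i and j
-- only. It expands into x, x^q, x^{q²}, x^{q³}, and invariance of the trace under y ↦ y^{q²} folds
-- the last two into the first two, so the trace of any multiple e of it is a trace word.
lemma traceWord_separates (hq1 : 1 ≤ q) (hq : q = p ^ m) (hF : Nat.card F = q ^ 2)
    (hE : Module.finrank F E = 2) (hE' : Nat.card E = q ^ 4) {ε : E} {n : ℕ}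
    (hε : ε ^ ((q - 1) * (q ^ 2 + 1)) = 1) (hω : IsPrimitiveRoot (ε ^ (q - 1)) n)
    (hε0 : ε ≠ 0) (i j k : Fin n) (hki : k ≠ i) (hkj : k ≠ j) :
    ∃ v, traceWord F q n ε v i = 0 ∧ traceWord F q n ε v j = 0 ∧ traceWord F q n ε v k ≠ 0 := by
  have : FiniteDimensional F E := Module.finite_of_finrank_pos (by omega)
  have : Finite F := Nat.finite_of_card_ne_zero (by rw [hF]; positivity)
  set ω := ε ^ (q - 1) with hωdef
  let w : Fin n → E := fun l =>
    ε ^ (l : ℕ) * ((ω ^ (l : ℕ) - ω ^ (i : ℕ)) * (ω ^ (l : ℕ) - ω ^ (j : ℕ)) ^ q)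
  have hne : ∀ l, k ≠ l → ω ^ (k : ℕ) - ω ^ (l : ℕ) ≠ 0 := fun l hl h =>
    hl (Fin.ext (hω.pow_inj k.2 l.2 (sub_eq_zero.mp h)))
  have hwk : w k ≠ 0 :=
    mul_ne_zero (pow_ne_zero _ hε0) (mul_ne_zero (hne i hki) (pow_ne_zero _ (hne j hkj)))
  obtain ⟨z, hz⟩ : ∃ z : E, Algebra.trace F E z ≠ 0 := by
    obtain ⟨z, hz⟩ := Algebra.trace_surjective F E 1
    exact ⟨z, by rw [hz]; exact one_ne_zero⟩
  -- Chosen so that the entry at k is the trace of z, which is nonzero.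
  set e : E := z / w k with he
  let a : E := e * ω ^ (i : ℕ) * (ω ^ (j : ℕ)) ^ q + e ^ q ^ 2
  let b : E := -(e * (ω ^ (j : ℕ)) ^ q) - (e * ω ^ (i : ℕ)) ^ q ^ 2
  have key : ∀ l, traceWord F q n ε (a, b) l = Algebra.trace F E (e * w l) := by
    intro l
    obtain ⟨h1, h2, h3⟩ := pow_mul_pow hq1 (pow_pow_eq_one hε l)
    have hωl : (ε ^ (l : ℕ)) ^ (q - 1) = ω ^ (l : ℕ) := by rw [hωdef, pow_right_comm]
    rw [hωl] at h1 h2 h3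
    set x := ε ^ (l : ℕ)
    set s := ω ^ (l : ℕ)
    set u := ω ^ (i : ℕ)
    set t := ω ^ (j : ℕ)
    have hw : e * w l = e * u * t ^ q * x + e * x ^ q ^ 2 - e * t ^ q * x ^ q
        - e * u * x ^ q ^ 3 := by
      simp only [w]
      rw [← h1, ← h2, ← h3, show (s - t) ^ q = s ^ q - t ^ q by
        conv_lhs => rw [hq, sub_pow_char_pow, ← hq]]
      ring
    have hv : a * x + b * x ^ q = e * u * t ^ q * x + e ^ q ^ 2 * x - e * t ^ q * x ^ q
        - (e * u) ^ q ^ 2 * x ^ q := by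
      simp only [a, b]
      ring
    have hp : ∀ y : E, y ^ q ^ 4 = y := pow_q_pow_four hE'
    have t1 : Algebra.trace F E (e ^ q ^ 2 * x) = Algebra.trace F E (e * x ^ q ^ 2) := by
      rw [← trace_pow hF hE hE' (e ^ q ^ 2 * x), mul_pow, ← pow_mul, ← pow_add, hp]
    have t2 : Algebra.trace F E ((e * u) ^ q ^ 2 * x ^ q) =
        Algebra.trace F E (e * u * x ^ q ^ 3) := by
      rw [← trace_pow hF hE hE' ((e * u) ^ q ^ 2 * x ^ q), mul_pow, ← pow_mul, ← pow_add, hp,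
        ← pow_mul, ← pow_succ']
    rw [traceWord_apply, hw]
    simp only
    rw [hv, map_sub, map_sub, map_add, t1, t2, map_sub, map_sub, map_add]
  have hq0 : q ≠ 0 := by omega
  refine ⟨(a, b), ?_, ?_, ?_⟩
  · rw [key]
    simp [w]
  · rw [key]
    simp [w, hq0]
  · rw [key, he, div_mul_cancel₀ _ hwk]
    exact hz

variable {p m} in
lemma card_zeroSet_traceWord (hq2 : 2 ≤ q) (hq : q = p ^ m) (hF : Nat.card F = q ^ 2)
    (hE : Module.finrank F E = 2) {ε : E}
    (hε : ε ^ ((q - 1) * (q ^ 2 + 1)) = 1) (hω : IsPrimitiveRoot (ε ^ (q - 1)) (q ^ 2 + 1))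
    (hε0 : ε ≠ 0) {v : E × E} (hv : v ≠ 0)
    (h3 : 3 ≤ (zeroSet (traceWord F q (q ^ 2 + 1) ε v)).card) :
    (zeroSet (traceWord F q (q ^ 2 + 1) ε v)).card = q + 1 := by
  classical
  obtain ⟨a, b⟩ := v
  set P := circlePoly q a b (a ^ q ^ 2) (b ^ q ^ 2) with hP
  have hz : ∀ i : Fin (q ^ 2 + 1), i ∈ zeroSet (traceWord F q (q ^ 2 + 1) ε (a, b)) ↔
      P.eval ((ε ^ (q - 1)) ^ (i : ℕ)) = 0 := by
    intro i
    rw [mem_zeroSet, ← (algebraMap F E).injective.eq_iff, map_zero,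
      algebraMap_traceWord_eq_eval p m hq (by omega) hF hE hε, mul_eq_zero]
    simp [hε0, hP]
  have hab : a ≠ 0 ∨ b ≠ 0 := by
    by_contra! h
    exact hv (Prod.ext h.1 h.2)
  obtain ⟨i, j, k, hi, hj, hk, hij, hik, hjk⟩ := Finset.two_lt_card_iff.mp h3
  have hne : ∀ {i j : Fin (q ^ 2 + 1)}, i ≠ j →
      (ε ^ (q - 1)) ^ (i : ℕ) ≠ (ε ^ (q - 1)) ^ (j : ℕ) :=
    fun {i j} hij h => hij (Fin.ext (hω.pow_inj i.2 j.2 h))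
  have hone : ∀ i : ℕ, ((ε ^ (q - 1)) ^ i) ^ (q ^ 2 + 1) = 1 := fun i => by
    rw [pow_right_comm, hω.pow_eq_one, one_pow]
  obtain ⟨hA, hdvd⟩ := circlePoly_dvd p m hq rfl hab (hne hij) (hne hik) (hne hjk)
    (hone i) (hone j) (hone k) ((hz i).mp hi) ((hz j).mp hj) ((hz k).mp hk)
  rw [← natDegree_circlePoly hq2 hA a b (b ^ q ^ 2), ← card_roots_of_dvd_X_pow_sub_one
    (Nat.succ_pos _) hω hdvd]
  congr 1
  ext i
  rw [hz, Finset.mem_filter, hP]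
  simp

variable {p m} in
-- A nonzero pair in the kernel would give a word with q² + 1 ≥ 3 zeros, hence exactly q + 1 zeros,
-- which is absurd.
lemma traceWord_injective (hq2 : 2 ≤ q) (hq : q = p ^ m) (hF : Nat.card F = q ^ 2)
    (hE : Module.finrank F E = 2) {ε : E}
    (hε : ε ^ ((q - 1) * (q ^ 2 + 1)) = 1) (hω : IsPrimitiveRoot (ε ^ (q - 1)) (q ^ 2 + 1))
    (hε0 : ε ≠ 0) : Function.Injective (traceWord F q (q ^ 2 + 1) ε) := by
  rw [← LinearMap.ker_eq_bot, LinearMap.ker_eq_bot']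
  intro v hv
  by_contra hv0
  have hcard : (zeroSet (traceWord F q (q ^ 2 + 1) ε v)).card = q ^ 2 + 1 := by
    rw [hv]
    simp [zeroSet]
  have h := card_zeroSet_traceWord hq2 hq hF hE hε hω hε0 hv0 (by rw [hcard]; nlinarith)
  rw [hcard] at h
  nlinarith

end TraceWords

/-! ### Constacyclic codes in terms of polynomials. -/

section ConstacyclicCodes

variable {F : Type*} [Field F] {n : ℕ}

/-- The polynomial `∑ cᵢ xⁱ` of a word `c`. -/
noncomputable def toPoly (F : Type*) [Field F] (n : ℕ) : (Fin n → F) →ₗ[F] F[X] :=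
  Fintype.linearCombination F fun i : Fin n => X ^ (i : ℕ)

lemma toPoly_apply (c : Fin n → F) : toPoly F n c = ∑ i : Fin n, C (c i) * X ^ (i : ℕ) := by
  simp [toPoly, Fintype.linearCombination_apply, smul_eq_C_mul]

lemma degree_toPoly_lt (c : Fin n → F) : (toPoly F n c).degree < n := by
  rw [toPoly_apply]
  exact degree_sum_fin_lt c

lemma coeff_toPoly (c : Fin n → F) (i : Fin n) : (toPoly F n c).coeff i = c i := by
  rw [toPoly_apply]
  simp [coeff_X_pow, Fin.val_inj]

lemma toQuotient_eq (lam : F) (c : Fin n → F) :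
    toQuotient n lam c = AdjoinRoot.mk (X ^ n - C lam) (toPoly F n c) := by
  simp [toQuotient, toPoly_apply, Algebra.smul_def, AdjoinRoot.algebraMap_eq]

lemma mem_constacyclicCode {lam : F} {g : F[X]} (hg : g ∣ X ^ n - C lam) {c : Fin n → F} :
    c ∈ constacyclicCode n lam g ↔ g ∣ toPoly F n c := by
  rw [constacyclicCode, Submodule.mem_comap, Submodule.restrictScalars_mem,
    Ideal.mem_span_singleton, toQuotient_eq]
  constructor
  · rintro ⟨y, hy⟩
    obtain ⟨u, rfl⟩ := AdjoinRoot.mk_surjective y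
    rw [← map_mul, AdjoinRoot.mk_eq_mk] at hy
    have h := dvd_add (hg.trans hy) (dvd_mul_right g u)
    rwa [sub_add_cancel] at h
  · exact fun h => map_dvd _ h

end ConstacyclicCodes

end ConstacyclicDesign

namespace ConstacyclicDesign

open Polynomial

/-! ### The code with check polynomial g₁ g_{q²-q+1} is an ovoid code. -/

section Main

variable {F E : Type*} [Field F] [Field E] [Algebra F E]

/-- As q² + 1 = (q - 1)(q + 1) + 2, a common prime divisor would be 2, but equal 2-adic valuations
make (q - 1)/r odd. -/
lemma coprime_div_of_padicValNat_eq {q r : ℕ} (hq : 1 < q) (hr : r ∣ q - 1)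
    (hν : padicValNat 2 r = padicValNat 2 (q - 1)) : ((q - 1) / r).Coprime (q ^ 2 + 1) := by
  obtain ⟨d, hd⟩ := hr
  have hr0 : r ≠ 0 := by
    rintro rfl
    omega
  have hd0 : d ≠ 0 := by
    rintro rfl
    omega
  have hodd : ¬ 2 ∣ d := by
    rw [hd, padicValNat.mul hr0 hd0] at hν
    have h0 : padicValNat 2 d = 0 := by omega
    rw [padicValNat.eq_zero_iff] at h0
    omega
  rw [hd, Nat.mul_div_cancel_left d (Nat.pos_of_ne_zero hr0)]
  refine Nat.Coprime.symm (Nat.coprime_of_dvd fun l hl hln hld => ?_)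
  have h1 : l ∣ q - 1 := hd ▸ dvd_mul_of_dvd_right hld r
  have h2 : l ∣ 2 := by
    have h3 : q ^ 2 + 1 = (q - 1) * (q + 1) + 2 := by
      obtain ⟨k, rfl⟩ : ∃ k, q = k + 1 := ⟨q - 1, by omega⟩
      rw [Nat.add_sub_cancel]
      ring
    rw [h3] at hln
    exact (Nat.dvd_add_right (dvd_mul_of_dvd_left h1 _)).mp hln
  exact hodd ((Nat.prime_dvd_prime_iff_eq hl Nat.prime_two).mp h2 ▸ hld)

/-- The truncated geometric series `∑ ρ⁻ⁱ Xⁱ` is divisible by the generator polynomial, for every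
zero `ρ` of the check polynomial. -/
lemma dvd_geom_sum {n : ℕ} {lam ρ : E} {g h : E[X]} (hgh : X ^ n - C lam = g * h)
    (hρ0 : ρ ≠ 0) (hρ : ρ ^ n = lam) (hh : h.IsRoot ρ) :
    g ∣ ∑ i : Fin n, C (ρ⁻¹ ^ (i : ℕ)) * X ^ (i : ℕ) := by
  obtain ⟨u, rfl⟩ := dvd_iff_isRoot.mpr hh
  -- The geometric sum equals (ρ/λ)(Xⁿ - λ)/(X - ρ).
  refine ⟨u * C (ρ * lam⁻¹), ?_⟩
  apply mul_left_cancel₀ (X_sub_C_ne_zero ρ)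
  have hsum : ∑ i : Fin n, C (ρ⁻¹ ^ (i : ℕ)) * X ^ (i : ℕ) =
      ∑ i ∈ Finset.range n, (C ρ⁻¹ * X) ^ i := by
    rw [Finset.sum_range]
    refine Finset.sum_congr rfl fun i _ => ?_
    rw [mul_pow, C_pow]
  have h1 := mul_neg_geom_sum (C ρ⁻¹ * X : E[X]) n
  have h2 : (C ρ * C ρ⁻¹ : E[X]) = 1 := by rw [← C_mul, mul_inv_cancel₀ hρ0, C_1]
  have hlam : lam ≠ 0 := hρ ▸ pow_ne_zero n hρ0
  have h3 : (C lam * C lam⁻¹ : E[X]) = 1 := by rw [← C_mul, mul_inv_cancel₀ hlam, C_1]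
  have h4 : (C ρ⁻¹ : E[X]) ^ n = C lam⁻¹ := by rw [← C_pow, inv_pow, hρ]
  rw [mul_pow, h4] at h1
  rw [hsum, C_mul]
  linear_combination (-C ρ) * h1 - X * (∑ i ∈ Finset.range n, (C ρ⁻¹ * X) ^ i) * h2
    + C ρ * C lam⁻¹ * hgh + C ρ * h3

variable {q : ℕ}

lemma isRoot_map_pow [Finite F] (hF : Nat.card F = q ^ 2) {f : F[X]} {y : E}
    (h : (f.map (algebraMap F E)).IsRoot y) :
    (f.map (algebraMap F E)).IsRoot (y ^ q ^ 2) := by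
  have := Fintype.ofFinite F
  rw [IsRoot.def, eval_map_algebraMap] at h ⊢
  have h1 := aeval_algHom_apply (FiniteField.frobeniusAlgHom F E) y f
  rw [h, map_zero, FiniteField.coe_frobeniusAlgHom, ← Nat.card_eq_fintype_card, hF] at h1
  exact h1

/-- The conjugates of δ over `F` are δ and δ^{q²}; if δ^{q³} were one of them, y^{q⁴} = y would give
δ^q = δ. -/
lemma minpoly_coprime [Finite E] (hF : Nat.card F = q ^ 2) (hE : Module.finrank F E = 2)
    (hE' : Nat.card E = q ^ 4) {δ : E} (hδ : δ ^ q ≠ δ) :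
    IsCoprime (minpoly F δ) (minpoly F (δ ^ q ^ 3)) := by
  have : FiniteDimensional F E := Module.finite_of_finrank_pos (by omega)
  have : Finite F := Finite.of_injective _ (algebraMap F E).injective
  have := Fintype.ofFinite F
  have hint : ∀ y : E, IsIntegral F y := fun y => Algebra.IsIntegral.isIntegral y
  refine ((minpoly.irreducible (hint _)).coprime_iff_not_dvd).mpr fun hdvd => ?_
  have heq : minpoly F (δ ^ q ^ 3) = minpoly F δ :=
    (eq_of_monic_of_associated (minpoly.monic (hint _)) (minpoly.monic (hint _))
      ((minpoly.irreducible (hint _)).associated_of_dvd (minpoly.irreducible (hint _)) hdvd)).symm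
  obtain ⟨σ, hσ⟩ := isConjRoot_iff_exists_algEquiv.mp heq
  obtain ⟨⟨k, hk⟩, rfl⟩ := (FiniteField.bijective_frobeniusAlgEquivOfAlgebraic_pow F E).2 σ
  simp only [AlgEquiv.coe_pow, FiniteField.coe_frobeniusAlgEquivOfAlgebraic_iterate,
    ← Nat.card_eq_fintype_card, hF] at hσ
  rw [hE] at hk
  have hp := fun y : E => pow_q_pow_four hE' y
  interval_cases k
  · have h := congrArg (· ^ q) hσ
    simp only [pow_zero, pow_one, ← pow_mul, ← pow_succ] at h
    rw [hp] at h
    exact hδ h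
  · have h := congrArg (· ^ q ^ 2) hσ
    simp only [pow_one, ← pow_mul, ← pow_add] at h
    rw [hp, show q ^ (3 + 2) = q ^ 4 * q by ring, pow_mul, hp] at h
    exact hδ h.symm

lemma finrank_eq_two (hq : 1 < q) (hF : Nat.card F = q ^ 2) (hE : Nat.card E = q ^ 4) :
    Module.finrank F E = 2 := by
  have : Finite E := Nat.finite_of_card_ne_zero (by rw [hE]; positivity)
  have h := Module.natCard_eq_pow_finrank (K := F) (V := E)
  rw [hF, hE, ← pow_mul] at h
  have := Nat.pow_right_injective hq h
  omega

/-- The trace words lie in the code. -/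
lemma traceWord_mem [Finite E] (p m : ℕ) [Fact p.Prime] [CharP E p] (hq : q = p ^ m)
    (hF : Nat.card F = q ^ 2) (hE : Module.finrank F E = 2) {n : ℕ} {lam : F} {g h : F[X]}
    (hgh : X ^ n - C lam = g * h) {δ : E} (hδ0 : δ ≠ 0)
    (hroot : ∀ j < 4, (δ ^ q ^ j) ^ n = algebraMap F E lam ∧
      (h.map (algebraMap F E)).IsRoot (δ ^ q ^ j)) (v : E × E) :
    traceWord F q n δ⁻¹ v ∈ constacyclicCode n lam g := by
  rw [mem_constacyclicCode ⟨h, hgh⟩, ← map_dvd_map' (algebraMap F E)]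
  have hgh' : X ^ n - C (algebraMap F E lam) =
      g.map (algebraMap F E) * h.map (algebraMap F E) := by
    rw [← Polynomial.map_mul, ← hgh]
    simp
  have hG := fun j hj => dvd_geom_sum hgh' (pow_ne_zero (q ^ j) hδ0) (hroot j hj).1 (hroot j hj).2
  obtain ⟨a, b⟩ := v
  -- The four conjugate terms of the trace split the word into four geometric sums, one for each
  -- zero δ^{q^j} of h.
  have hsum : (toPoly F n (traceWord F q n δ⁻¹ (a, b))).map (algebraMap F E) =
      C a * ∑ i : Fin n, C ((δ ^ q ^ 0)⁻¹ ^ (i : ℕ)) * X ^ (i : ℕ)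
      + C b * ∑ i : Fin n, C ((δ ^ q ^ 1)⁻¹ ^ (i : ℕ)) * X ^ (i : ℕ)
      + C (a ^ q ^ 2) * ∑ i : Fin n, C ((δ ^ q ^ 2)⁻¹ ^ (i : ℕ)) * X ^ (i : ℕ)
      + C (b ^ q ^ 2) * ∑ i : Fin n, C ((δ ^ q ^ 3)⁻¹ ^ (i : ℕ)) * X ^ (i : ℕ) := by
    rw [toPoly_apply, Polynomial.map_sum, Finset.mul_sum, Finset.mul_sum, Finset.mul_sum,
      Finset.mul_sum, ← Finset.sum_add_distrib, ← Finset.sum_add_distrib,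
      ← Finset.sum_add_distrib]
    refine Finset.sum_congr rfl fun i _ => ?_
    rw [Polynomial.map_mul, map_C, Polynomial.map_pow, map_X,
      algebraMap_traceWord p m hq hF hE, ← mul_assoc, ← mul_assoc, ← mul_assoc, ← mul_assoc,
      ← C_mul, ← C_mul, ← C_mul, ← C_mul, ← add_mul, ← add_mul, ← add_mul, ← C_add, ← C_add,
      ← C_add]
    simp only [inv_pow, pow_zero, pow_one, pow_right_comm]
  rw [hsum]
  exact dvd_add (dvd_add (dvd_add (dvd_mul_of_dvd_right (hG 0 (by norm_num)) _)
    (dvd_mul_of_dvd_right (hG 1 (by norm_num)) _)) (dvd_mul_of_dvd_right (hG 2 (by norm_num)) _))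
    (dvd_mul_of_dvd_right (hG 3 (by norm_num)) _)

/-- A code whose check polynomial is a product of two minimal polynomials over `F` of elements of
`E` has dimension at most twice the degree of `E` over `F`. -/
lemma finrank_constacyclicCode_le [FiniteDimensional F E] {n : ℕ} {lam : F} {g : F[X]} {δ γ : E}
    (hgh : X ^ n - C lam = g * (minpoly F δ * minpoly F γ)) (hn : (n : F) ≠ 0) (hlam : lam ≠ 0) :
    Module.finrank F (constacyclicCode n lam g) ≤ 2 * Module.finrank F E := by
  let f : (Fin n → F) →ₗ[F] E × E :=
    ((aeval δ).toLinearMap.prod (aeval γ).toLinearMap).comp (toPoly F n)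
  have hinj : Function.Injective (f.domRestrict (constacyclicCode n lam g)) := by
    rw [← LinearMap.ker_eq_bot, LinearMap.ker_eq_bot']
    rintro ⟨c, hc⟩ hfc
    rw [mem_constacyclicCode ⟨_, hgh⟩] at hc
    have h1 : aeval δ (toPoly F n c) = 0 := congrArg Prod.fst hfc
    have h2 : aeval γ (toPoly F n c) = 0 := congrArg Prod.snd hfc
    have hsep : (X ^ n - C lam).Separable := separable_X_pow_sub_C lam hn hlam
    rw [hgh] at hsep
    have hcop := hsep.isCoprime
    have hcop' := hsep.of_mul_right.isCoprime
    -- A codeword killed by evaluation at δ and γ is divisible by g and both minimal polynomials,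
    -- which are pairwise coprime by separability.
    have hdvd : X ^ n - C lam ∣ toPoly F n c := by
      rw [hgh]
      exact hcop.mul_dvd hc (hcop'.mul_dvd (minpoly.dvd F δ h1) (minpoly.dvd F γ h2))
    have hn0 : 0 < n := Nat.pos_of_ne_zero fun h => hn (by rw [h, Nat.cast_zero])
    have h0 : toPoly F n c = 0 := by
      refine eq_zero_of_dvd_of_degree_lt hdvd ?_
      rw [degree_X_pow_sub_C hn0]
      exact degree_toPoly_lt c
    ext i
    change c i = 0
    rw [← coeff_toPoly c i, h0, coeff_zero]
  refine (LinearMap.finrank_le_finrank_of_injective hinj).trans_eq ?_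
  rw [Module.finrank_prod, two_mul]

/-- The code `𝒞(1, q²-q+1)` is an ovoid code, and its check polynomial divides `xⁿ - lam`. -/
theorem isOvoidCode_secondCode {q r : ℕ} (hq : IsPrimePow q) (hq2 : 2 < q)
    (hF : Nat.card F = q ^ 2) (hE : Nat.card E = q ^ 4) (lam : Fˣ) (hlam : orderOf lam = r)
    (hr : r ∣ q - 1) (hν : padicValNat 2 r = padicValNat 2 (q - 1))
    {δ : E} (hδ : IsPrimitiveRoot δ (r * (q ^ 2 + 1)))
    (hδlam : δ ^ (q ^ 2 + 1) = algebraMap F E lam) :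
    checkPoly F q δ ∣ X ^ (q ^ 2 + 1) - C (lam : F) ∧
      IsOvoidCode q (secondCode q (lam : F) δ) := by
  obtain ⟨p, m, hp, hm, hpm⟩ := hq
  have : Fact p.Prime := ⟨hp.nat_prime⟩
  have : Finite E := Nat.finite_of_card_ne_zero (by rw [hE]; positivity)
  have : Finite F := Nat.finite_of_card_ne_zero (by rw [hF]; positivity)
  have : CharP E p := by
    have := Fintype.ofFinite E
    refine charP_of_card_eq_prime_pow (f := m * 4) ?_
    rw [← Nat.card_eq_fintype_card, hE, ← hpm, pow_mul]
  have : CharP F p := by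
    have := Fintype.ofFinite F
    refine charP_of_card_eq_prime_pow (f := m * 2) ?_
    rw [← Nat.card_eq_fintype_card, hF, ← hpm, pow_mul]
  have hE2 := finrank_eq_two (F := F) (E := E) (by omega) hF hE
  have : FiniteDimensional F E := Module.finite_of_finrank_pos (by omega)
  have hr0 : 0 < r := Nat.pos_of_dvd_of_pos hr (by omega)
  have hδ0 : δ ≠ 0 := hδ.ne_zero (by positivity)
  have hlamq : (algebraMap F E lam) ^ q = algebraMap F E lam := by
    have h1 : lam ^ (q - 1) = 1 := orderOf_dvd_iff_pow_eq_one.mp (hlam ▸ hr)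
    have h2 : (lam : F) ^ q = lam := by
      rw [← Nat.sub_add_cancel (show 1 ≤ q by omega), pow_succ, ← Units.val_pow_eq_pow_val, h1,
        Units.val_one, one_mul]
    rw [← map_pow, h2]
  have hlamj : ∀ j, (algebraMap F E lam) ^ q ^ j = algebraMap F E lam := by
    intro j
    induction j with
    | zero => simp
    | succ j ih => rw [pow_succ, pow_mul, ih, hlamq]
  have hpown : ∀ j, (δ ^ q ^ j) ^ (q ^ 2 + 1) = algebraMap F E lam := by
    intro j
    rw [pow_right_comm, hδlam, hlamj]
  have hδ1 : δ ^ ((q - 1) * (q ^ 2 + 1)) = 1 :=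
    (hδ.pow_eq_one_iff_dvd _).mpr (Nat.mul_dvd_mul_right hr _)
  have hγ : δ ^ (q ^ 2 - q + 1) = δ ^ q ^ 3 := by
    obtain ⟨k, rfl⟩ : ∃ k, q = k + 1 := ⟨q - 1, by omega⟩
    have e : (k + 1) ^ 2 - (k + 1) = k * (k + 1) := by
      have : (k + 1) ^ 2 = k * (k + 1) + (k + 1) := by ring
      omega
    rw [Nat.add_sub_cancel] at hδ1
    rw [e]
    calc δ ^ (k * (k + 1) + 1) = δ ^ (k * (k + 1) + 1) * δ ^ (k * ((k + 1) ^ 2 + 1)) := by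
          rw [hδ1, mul_one]
      _ = δ ^ (k + 1) ^ 3 := by ring
  have hδq : δ ^ q ≠ δ := by
    intro h
    have h1 : δ ^ (q - 1) = 1 := by
      apply mul_right_cancel₀ hδ0
      rw [← pow_succ, Nat.sub_add_cancel (by omega), h, one_mul]
    have h2 := Nat.le_of_dvd (by omega) ((hδ.pow_eq_one_iff_dvd _).mp h1)
    have h3 : q ^ 2 + 1 ≤ r * (q ^ 2 + 1) := Nat.le_mul_of_pos_left _ hr0
    have h4 : q ≤ q ^ 2 := Nat.le_self_pow two_ne_zero q
    omega
  have hcheck : checkPoly F q δ = minpoly F δ * minpoly F (δ ^ q ^ 3) := by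
    rw [checkPoly, hγ]
  have hmin : ∀ j, minpoly F (δ ^ q ^ j) ∣ X ^ (q ^ 2 + 1) - C (lam : F) := by
    intro j
    apply minpoly.dvd
    simp [hpown j]
  have hdvd : checkPoly F q δ ∣ X ^ (q ^ 2 + 1) - C (lam : F) := by
    rw [hcheck]
    exact (minpoly_coprime hF hE2 hE hδq).mul_dvd (by simpa using hmin 0) (hmin 3)
  have hh0 : checkPoly F q δ ≠ 0 :=
    ne_zero_of_dvd_ne_zero (monic_X_pow_sub_C (lam : F) (by omega)).ne_zero hdvd
  have hgh : X ^ (q ^ 2 + 1) - C (lam : F) =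
      (X ^ (q ^ 2 + 1) - C (lam : F)) / checkPoly F q δ * checkPoly F q δ :=
    (mul_comm _ _).trans (EuclideanDomain.mul_div_cancel' hh0 hdvd) |>.symm
  refine ⟨hdvd, ?_⟩
  have hroot : ∀ j < 4, ((checkPoly F q δ).map (algebraMap F E)).IsRoot (δ ^ q ^ j) := by
    have hm : ∀ y : E, ((minpoly F y).map (algebraMap F E)).IsRoot y := fun y => by
      rw [IsRoot.def, eval_map_algebraMap, minpoly.aeval]
    have hr0 : ((checkPoly F q δ).map (algebraMap F E)).IsRoot δ := by
      rw [hcheck, Polynomial.map_mul]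
      exact root_mul_right_of_isRoot _ (hm δ)
    have hr3 : ((checkPoly F q δ).map (algebraMap F E)).IsRoot (δ ^ q ^ 3) := by
      rw [hcheck, Polynomial.map_mul]
      exact root_mul_left_of_isRoot _ (hm _)
    intro j hj
    interval_cases j
    · simpa using hr0
    -- δ^q is the conjugate of δ^{q³}, since (δ^{q³})^{q²} = δ^{q⁵} = δ^q.
    · have h := isRoot_map_pow hF hr3
      rwa [← pow_mul, ← pow_add, show q ^ (3 + 2) = q ^ 4 * q ^ 1 by ring, pow_mul,
        pow_q_pow_four hE] at h
    · exact isRoot_map_pow hF hr0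
    · exact hr3
  have hε : δ⁻¹ ^ ((q - 1) * (q ^ 2 + 1)) = 1 := by rw [inv_pow, hδ1, inv_one]
  have hω : IsPrimitiveRoot (δ⁻¹ ^ (q - 1)) (q ^ 2 + 1) := by
    have h1 : IsPrimitiveRoot (δ⁻¹ ^ r) (q ^ 2 + 1) := hδ.inv.pow (by positivity) rfl
    have h2 := h1.pow_of_coprime _ (coprime_div_of_padicValNat_eq (by omega) hr hν)
    rwa [← pow_mul, Nat.mul_div_cancel' hr] at h2
  have hε0 : δ⁻¹ ≠ 0 := inv_ne_zero hδ0
  have hmem : ∀ v, traceWord F q (q ^ 2 + 1) δ⁻¹ v ∈ secondCode q (lam : F) δ := fun v =>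
    traceWord_mem p m hpm.symm hF hE2 hgh hδ0 (fun j hj => ⟨hpown j, hroot j hj⟩) v
  have hinj := traceWord_injective (F := F) (by omega) hpm.symm hF hE2 hε hω hε0
  have hle : LinearMap.range (traceWord F q (q ^ 2 + 1) δ⁻¹) ≤ secondCode q (lam : F) δ := by
    rintro _ ⟨v, rfl⟩
    exact hmem v
  have hrange : Module.finrank F (LinearMap.range (traceWord F q (q ^ 2 + 1) δ⁻¹)) = 4 := by
    rw [LinearMap.finrank_range_of_inj hinj, Module.finrank_prod, hE2]
  have hn : ((q ^ 2 + 1 : ℕ) : F) ≠ 0 := by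
    have : (q : F) = 0 := by
      rw [← hpm, Nat.cast_pow, CharP.cast_eq_zero, zero_pow hm.ne']
    simp [this]
  have hupper : Module.finrank F (secondCode q (lam : F) δ) ≤ 4 := by
    have h := hgh
    -- Only the factor is expanded; the divisor keeps the form used in `secondCode`.
    nth_rw 2 [hcheck] at h
    exact (finrank_constacyclicCode_le h hn lam.ne_zero).trans_eq (by rw [hE2])
  have hfin : Module.finrank F (secondCode q (lam : F) δ) = 4 :=
    le_antisymm hupper (hrange ▸ Submodule.finrank_mono hle)
  have heq : LinearMap.range (traceWord F q (q ^ 2 + 1) δ⁻¹) = secondCode q (lam : F) δ :=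
    Submodule.eq_of_le_of_finrank_eq hle (by rw [hrange, hfin])
  refine ⟨hfin, ?_, ?_⟩
  · intro i j k hki hkj
    obtain ⟨v, h⟩ := traceWord_separates (F := F) (by omega) hpm.symm hF hE2 hE hε hω hε0 i j k
      hki hkj
    exact ⟨_, hmem v, h⟩
  · intro c hc hc0 h3
    rw [← heq] at hc
    obtain ⟨v, rfl⟩ := hc
    refine card_zeroSet_traceWord (by omega) hpm.symm hF hE2 hε hω hε0 ?_ h3
    rintro rfl
    exact hc0 (map_zero _)

end Main

end ConstacyclicDesign

open Polynomial ConstacyclicDesign in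
theorem theorem2 {F E : Type*} [Field F] [Field E] [Algebra F E]
    (q r : ℕ) (hq : IsPrimePow q) (hq2 : 2 < q)
    (hF : Nat.card F = q ^ 2) (hE : Nat.card E = q ^ 4)
    (lam : Fˣ) (hlam : orderOf lam = r)
    (hr : r ∣ q - 1) (hν : padicValNat 2 r = padicValNat 2 (q - 1))
    (δ : E) (hδ : IsPrimitiveRoot δ (r * (q ^ 2 + 1)))
    (hδlam : δ ^ (q ^ 2 + 1) = algebraMap F E lam) :
    checkPoly F q δ ∣ X ^ (q ^ 2 + 1) - C (lam : F) ∧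
    HasParameters (secondCode q (lam : F) δ) 4 (q ^ 2 - q) ∧
    weightEnumerator (secondCode q (lam : F) δ) =
      1 + C ((q : ℚ) ^ 5 - q) * X ^ (q ^ 2 - q)
        + C (((q : ℚ) ^ 4 - 1) * (q - 1) * q ^ 3 / 2) * (X ^ (q ^ 2 - 1) + X ^ (q ^ 2 + 1))
        + C ((q : ℚ) ^ 7 - q ^ 5 + q ^ 4 - q ^ 3 + q - 1) * X ^ (q ^ 2) ∧
    SupportsDesign (secondCode q (lam : F) δ) 3 (q ^ 2 - q) ((q ^ 2 - q - 1) * (q - 2)) ∧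
    HasParameters (dualCode (secondCode q (lam : F) δ)) (q ^ 2 - 3) 4 ∧
    SupportsDesign (dualCode (secondCode q (lam : F) δ)) 3 4 (q - 2) := by
  obtain ⟨hdvd, hD⟩ := isOvoidCode_secondCode hq hq2 hF hE lam hlam hr hν hδ hδlam
  have : Finite F := Nat.finite_of_card_ne_zero (by rw [hF]; positivity)
  have := Fintype.ofFinite F
  exact ⟨hdvd, hD.hasParameters hq2 rfl,
    hD.weightEnumerator_eq hq2 rfl (by rw [← Nat.card_eq_fintype_card, hF]),
    hD.supportsDesign hq2 rfl, hD.hasParameters_dualCode hq2 rfl, hD.supportsDesign_dualCode hq2 rfl⟩
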